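/- Let $E$ be a Hilbert $C^*$-module over a $C^*$-algebra $A$ and let $\mathcal L(E)$ be the $C^*$-algebra of adjointable operators on $E$. A *regular operator* in $E$ is a densely defined closed $A$-linear operator $T$ whose adjoint $T^*$ is densely defined and for which $1+T^*T$ has dense range; $\mathcal R(E)$ is the set of regular operators. $T\in\mathcal R(E)$ is *normal* if $D(T)=D(T^*)$ and $\langle Tv,Tv\rangle=\langle T^*v,T^*v\rangle$ for all $v\in D(T)$; it is *invertible* if it is injective and $T^{-1}$ (with domain the range of $T$) is regular. The *spectrum* $\sigma(T)$ is the set of $c\in\mathbb C$ for which there is no $S\in\mathcal L(E)$ with $S(T-c1)\subseteq (T-c1)S=1$. The *$z$-transform* of $T\in\mathcal R(E)$ is the unique $z_T\in\mathcal L(E)$ with $\|z_T\|\le 1$, $D(T)=(1-z_T^*z_T)^{1/2}E$ and $T(1-z_T^*z_T)^{1/2}v=z_Tv$ for all $v\in E$. If $X$ is a locally compact Hausdorff space and $\pi:C_0(X)\to\mathcal L(E)$ is a non-degenerate $*$-homomorphism (that is, $\pi(C_0(X))E$ has dense linear span), extended canonically to $C_b(X)$, then for $f\in C(X)$ the operator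 $\pi(f)\in\mathcal R(E)$ is the one with $z_{\pi(f)}=\pi\bigl(f(1+|f|^2)^{-1/2}\bigr)$. For $G\subseteq\mathbb C$, $\iota_G$ is the identity function on $G$ and $f_G$ is the restriction of $f$ to $G$. Let $T\in\mathcal R(E)$ be normal. 1. There is a unique non-degenerate $*$-homomorphism $\psi_T:C_0(\sigma(T))\to\mathcal L(E)$ with $\psi_T(\iota_{\sigma(T)})=T$, and it is injective. For $f\in C(\sigma(T))$ write $f(T)=\psi_T(f)$ (the usual functional calculus). 2. Let $K\subset\mathbb C$ be finite and such that $T-\lambda 1$ is invertible for every $\lambda\in K$. Then there is a unique non-degenerate $*$-homomorphism $\pi_K:C_0(\sigma(T)\setminus K)\to\mathcal L(E)$ with $\pi_K(\iota_{\sigma(T)\setminus K})=T$. Moreover $f(T)=\pi_K(f_{\sigma(T)\setminus K})$ for every $f\in C(\sigma(T))$. 3. Call a continuous function $f:D\to\mathbb C$, $D\subseteq\mathbb C$, *compatible* with $T$ if $\sigma(T)\setminus K\subseteq D$ for some $K$ as in 2. For such $f$ the operator $f(T)=\pi_K(f_{\sigma(T)\setminus K})$ is a normal regular operator that does not depend on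 the choice of $K$ as in 2 with $\sigma(T)\setminus K\subseteq D$. 4. Call $G\subseteq\mathbb C$ *compatible* with $T$ if $G\cup L$ is closed for some finite $L\subset\mathbb C$ and $\sigma(T)\setminus K\subseteq G$ for some $K$ as in 2. For such $G$ there is a unique non-degenerate $*$-homomorphism $\pi:C_0(G)\to\mathcal L(E)$ with $\pi(\iota_G)=T$; it satisfies $\pi(g)=g(T)$ for every $g\in C_0(G)$ (in particular $g(T)\in\mathcal L(E)$) and, more generally, $\pi(f)=f(T)$ for every $f\in C(G)$, where $g(T)$ and $f(T)$ are the operators of 3. -/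

import Mathlib

open scoped ZeroAtInfty

noncomputable section

namespace HilbertModule

/-! Throughout, `E` is a Hilbert C⋆-module over the (possibly non-unital) C⋆-algebra `A`, that is,
a complete `CStarModule A E`. Mathlib writes the `A`-action on the left and lets the inner product
be linear in the second variable; a right Hilbert module over `B` is the case `A = Bᵐᵒᵖ`. -/

section Adjointable

variable (A E : Type*) [NonUnitalCStarAlgebra A] [PartialOrder A] [StarOrderedRing A]
  [NormedAddCommGroup E] [NormedSpace ℂ E] [SMul A E] [CStarModule A E]

/-- The adjointable operators on `E`, as a subalgebra of the bounded operators. -/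
def adjointables : Subalgebra ℂ (E →L[ℂ] E) where
  carrier := {T | ∃ S : E →L[ℂ] E, ∀ x y, inner A (T x) y = inner A x (S y)}
  mul_mem' := by
    rintro T T' ⟨S, hS⟩ ⟨S', hS'⟩
    exact ⟨S' * S, fun x y => by
      rw [mul_apply_eq_comp, hS, hS', mul_apply_eq_comp]⟩
  add_mem' := by
    rintro T T' ⟨S, hS⟩ ⟨S', hS'⟩
    exact ⟨S + S', fun x y => by
      simp only [add_apply, CStarModule.inner_add_left,
        CStarModule.inner_add_right, hS, hS']⟩
  algebraMap_mem' := by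
    intro c
    refine ⟨algebraMap ℂ (E →L[ℂ] E) (star c), fun x y => ?_⟩
    simp [Algebra.algebraMap_eq_smul_one]

/-- The algebra `𝓛(E)` of adjointable operators on `E`, with the operator norm. -/
def Adjointable : Type _ := adjointables A E

instance : NormedRing (Adjointable A E) := inferInstanceAs (NormedRing (adjointables A E))

instance : NormedAlgebra ℂ (Adjointable A E) :=
  inferInstanceAs (NormedAlgebra ℂ (adjointables A E))

variable {A E}

theorem eq_of_forall_inner {v w : E} (h : ∀ x : E, inner A x v = inner A x w) : v = w := by
  have h1 : inner A (v - w) (v - w) = (0 : A) := by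
    rw [CStarModule.inner_sub_right, h, sub_self]
  exact sub_eq_zero.mp (CStarModule.inner_self.mp h1)

/-- The adjoint of an adjointable operator. -/
instance : Star (Adjointable A E) where
  star T := ⟨T.2.choose, T.1, fun x y => by
    have h := T.2.choose_spec y x
    have h' := congrArg star h
    rw [CStarModule.star_inner, CStarModule.star_inner] at h'
    exact h'.symm⟩

theorem val_mul (S T : Adjointable A E) (x : E) : (S * T).1 x = S.1 (T.1 x) := rfl

theorem val_add (S T : Adjointable A E) (x : E) : (S + T).1 x = S.1 x + T.1 x := rfl

theorem val_smul (c : ℂ) (T : Adjointable A E) (x : E) : (c • T).1 x = c • T.1 x := rfl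

theorem norm_val (T : Adjointable A E) : ‖T.1‖ = ‖T‖ := rfl

theorem isometry_val : Isometry fun T : Adjointable A E => T.1 :=
  Isometry.of_dist_eq fun _ _ => rfl

theorem inner_apply_left (T : Adjointable A E) (x y : E) :
    inner A (T.1 x) y = inner A x ((star T).1 y) := T.2.choose_spec x y

theorem inner_apply_right (T : Adjointable A E) (x y : E) :
    inner A x (T.1 y) = inner A ((star T).1 x) y := by
  have h' := congrArg star (inner_apply_left T y x)
  rw [CStarModule.star_inner, CStarModule.star_inner] at h'
  exact h'

theorem adjointable_ext {S T : Adjointable A E}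
    (h : ∀ x y : E, inner A x (S.1 y) = inner A x (T.1 y)) : S = T :=
  Subtype.ext (ContinuousLinearMap.ext fun y => eq_of_forall_inner fun x => h x y)

instance : StarRing (Adjointable A E) where
  star_involutive T := adjointable_ext fun x y => by
    rw [← inner_apply_left, ← inner_apply_right]
  star_mul S T := adjointable_ext fun x y => by
    rw [← inner_apply_left]
    simp only [val_mul]
    rw [inner_apply_left, inner_apply_left]
  star_add S T := adjointable_ext fun x y => by
    rw [← inner_apply_left]
    simp only [val_add, CStarModule.inner_add_left,
      CStarModule.inner_add_right, inner_apply_left]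

instance : StarModule ℂ (Adjointable A E) where
  star_smul c T := adjointable_ext fun x y => by
    rw [← inner_apply_left]
    simp only [val_smul,
      CStarModule.inner_smul_left_complex, CStarModule.inner_smul_right_complex, inner_apply_left]

instance : CStarRing (Adjointable A E) where
  norm_mul_self_le T := by
    have key : ‖T.1‖ ≤ √‖star T * T‖ := by
      refine ContinuousLinearMap.opNorm_le_bound _ (Real.sqrt_nonneg _) fun x => ?_
      have h1 : ‖T.1 x‖ ^ 2 ≤ ‖star T * T‖ * ‖x‖ ^ 2 := by
        calc ‖T.1 x‖ ^ 2 = ‖inner A (T.1 x) (T.1 x)‖ := CStarModule.norm_sq_eq A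
          _ = ‖inner A x ((star T * T).1 x)‖ := by rw [inner_apply_left]; rfl
          _ ≤ ‖x‖ * ‖(star T * T).1 x‖ := CStarModule.norm_inner_le E
          _ ≤ ‖x‖ * (‖star T * T‖ * ‖x‖) := by
              gcongr
              exact (star T * T).1.le_opNorm x
          _ = _ := by ring
      calc ‖T.1 x‖ = √(‖T.1 x‖ ^ 2) := (Real.sqrt_sq (norm_nonneg _)).symm
        _ ≤ √(‖star T * T‖ * ‖x‖ ^ 2) := Real.sqrt_le_sqrt h1
        _ = √‖star T * T‖ * ‖x‖ := by
            rw [Real.sqrt_mul (norm_nonneg (star T * T)), Real.sqrt_sq (norm_nonneg x)]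
    calc ‖T‖ * ‖T‖ ≤ √‖star T * T‖ * √‖star T * T‖ := by
          gcongr <;> exact key
      _ = ‖star T * T‖ := Real.mul_self_sqrt (norm_nonneg _)

instance [CompleteSpace E] : CompleteSpace (Adjointable A E) := by
  refine Metric.complete_of_cauchySeq_tendsto fun u hu => ?_
  have hiso : Isometry (fun T : Adjointable A E => star T) := Isometry.of_dist_eq fun S T => by
    rw [dist_eq_norm, dist_eq_norm, ← star_sub, norm_star]
  have hu1 : CauchySeq fun n => (u n).1 := hu.map isometry_val.uniformContinuous
  have hu2 : CauchySeq fun n => (star (u n)).1 :=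
    (hu.map hiso.uniformContinuous).map isometry_val.uniformContinuous
  obtain ⟨T, hT⟩ := cauchySeq_tendsto_of_complete hu1
  obtain ⟨S, hS⟩ := cauchySeq_tendsto_of_complete hu2
  have hTS : ∀ x y, inner A (T x) y = inner A x (S y) := by
    intro x y
    have h1 : Filter.Tendsto (fun n => inner A ((u n).1 x) y) Filter.atTop
        (nhds (inner A (T x) y)) := by
      have hx : Filter.Tendsto (fun n => (u n).1 x) Filter.atTop (nhds (T x)) :=
        ((ContinuousLinearMap.apply ℂ E x).continuous.tendsto T).comp hT
      exact (CStarModule.continuous_inner.tendsto (T x, y)).comp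
        (hx.prodMk_nhds tendsto_const_nhds)
    have h2 : Filter.Tendsto (fun n => inner A x ((star (u n)).1 y)) Filter.atTop
        (nhds (inner A x (S y))) := by
      have hy : Filter.Tendsto (fun n => (star (u n)).1 y) Filter.atTop (nhds (S y)) :=
        ((ContinuousLinearMap.apply ℂ E y).continuous.tendsto S).comp hS
      exact (CStarModule.continuous_inner.tendsto (x, S y)).comp
        (tendsto_const_nhds.prodMk_nhds hy)
    simp only [inner_apply_left] at h1
    exact tendsto_nhds_unique h1 h2
  exact ⟨⟨T, S, hTS⟩, isometry_val.isEmbedding.tendsto_nhds_iff.mpr hT⟩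

/-- `𝓛(E)` is a unital C⋆-algebra. -/
instance [CompleteSpace E] : CStarAlgebra (Adjointable A E) where

end Adjointable

section Regular

variable (A : Type*) {E : Type*} [NonUnitalCStarAlgebra A] [PartialOrder A] [StarOrderedRing A]
  [NormedAddCommGroup E] [NormedSpace ℂ E] [SMul A E] [CStarModule A E]

/-- The set of pairs `(v, w)` with `⟨T u, v⟩ = ⟨u, w⟩` for all `u ∈ D(T)`. -/
def adjointGraph (T : E →ₗ.[ℂ] E) : Submodule ℂ (E × E) where
  carrier := {p | ∀ u : T.domain, inner A (T u) p.1 = inner A (u : E) p.2}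
  add_mem' := by
    intro p q hp hq u
    simp only [Prod.fst_add, Prod.snd_add, CStarModule.inner_add_right, hp u, hq u]
  zero_mem' := by
    intro u
    simp
  smul_mem' := by
    intro c p hp u
    simp only [Prod.smul_fst, Prod.smul_snd, CStarModule.inner_smul_right_complex, hp u]

/-- The adjoint `T⋆` of a densely defined operator. -/
def adjoint (T : E →ₗ.[ℂ] E) : E →ₗ.[ℂ] E := (adjointGraph A T).toLinearPMap

/-- Regular operators in `E`: densely defined closed `A`-linear operators whose adjoint is densely
defined and for which `1 + T⋆T` has dense range. -/
structure IsRegular (T : E →ₗ.[ℂ] E) : Prop where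
  dense_domain : Dense (T.domain : Set E)
  smul_mem : ∀ (a : A) (x : E), x ∈ T.domain → a • x ∈ T.domain
  map_smul : ∀ (a : A) (x : E) (hx : x ∈ T.domain),
    T ⟨a • x, smul_mem a x hx⟩ = a • T ⟨x, hx⟩
  isClosed : T.IsClosed
  dense_domain_adjoint : Dense ((adjoint A T).domain : Set E)
  dense_range : Dense {y : E | ∃ (x : T.domain) (h : T x ∈ (adjoint A T).domain),
    y = (x : E) + adjoint A T ⟨T x, h⟩}

/-- Normality: `D(T) = D(T⋆)` and `⟨T v, T v⟩ = ⟨T⋆ v, T⋆ v⟩` for all `v ∈ D(T)`. -/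
def IsNormal (T : E →ₗ.[ℂ] E) : Prop :=
  ∃ h : T.domain = (adjoint A T).domain, ∀ v : T.domain,
    inner A (T v) (T v) =
      inner A (adjoint A T ⟨v, h ▸ v.2⟩) (adjoint A T ⟨v, h ▸ v.2⟩)

/-- Invertibility in the sense of regular operators: `T` is injective and `T⁻¹`, with domain the
range of `T`, is regular. -/
def IsInvertible (T : E →ₗ.[ℂ] E) : Prop :=
  (∀ x y : T.domain, T x = T y → x = y) ∧ IsRegular A T.inverse

/-- The operator `T - c 1` with domain `D(T)`. -/
def subScalar (T : E →ₗ.[ℂ] E) (c : ℂ) : E →ₗ.[ℂ] E where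
  domain := T.domain
  toFun := T.toFun - c • T.domain.subtype

/-- Adjointable invertibility: there is `S ∈ 𝓛(E)` with `S T ⊆ T S = 1`. -/
def IsAdjointableInvertible (T : E →ₗ.[ℂ] E) : Prop :=
  ∃ S : Adjointable A E, (∀ x : T.domain, S.1 (T x) = x) ∧
    ∀ y : E, ∃ h : S.1 y ∈ T.domain, T ⟨S.1 y, h⟩ = y

/-- The spectrum `σ(T)`. -/
def opSpectrum (T : E →ₗ.[ℂ] E) : Set ℂ :=
  {c | ¬ IsAdjointableInvertible A (subScalar T c)}

end Regular

section Calculus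

variable {A E : Type*} [NonUnitalCStarAlgebra A] [PartialOrder A] [StarOrderedRing A]
  [NormedAddCommGroup E] [NormedSpace ℂ E] [SMul A E] [CStarModule A E] [CompleteSpace E]

/-- The operator with `z`-transform `z`: its domain is `(1 - z⋆z)^{1/2} E`, and it sends
`(1 - z⋆z)^{1/2} v` to `z v`. -/
def ofZTransform (z : Adjointable A E) : E →ₗ.[ℂ] E :=
  (LinearMap.range
    (((cfc Real.sqrt (1 - star z * z)).1 : E →ₗ[ℂ] E).prod (z.1 : E →ₗ[ℂ] E))).toLinearPMap

variable {X : Type*} [TopologicalSpace X]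

/-- The product of a bounded continuous function and a function vanishing at infinity. -/
def bcfMul (m : BoundedContinuousFunction X ℂ) (g : C₀(X, ℂ)) : C₀(X, ℂ) where
  toFun x := m x * g x
  continuous_toFun := m.continuous.mul g.continuous
  zero_at_infty' := by
    refine squeeze_zero_norm (a := fun x => ‖m‖ * ‖g x‖) (fun x => ?_) ?_
    · rw [norm_mul]
      exact mul_le_mul_of_nonneg_right (m.norm_coe_le_norm x) (norm_nonneg _)
    · simpa using (g.zero_at_infty'.norm).const_mul ‖m‖

/-- A continuous function `f` on `X`, regarded as an element affiliated with `C₀(X)` (acting by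
multiplication on `{g | f g ∈ C₀(X)}`), has `z`-transform `f (1 + |f|²)^{-1/2}` in
`M(C₀(X)) = C_b(X)`. -/
def zFun (f : C(X, ℂ)) : BoundedContinuousFunction X ℂ :=
  BoundedContinuousFunction.ofNormedAddCommGroup
    (fun x => f x / ((√(1 + ‖f x‖ ^ 2) : ℝ) : ℂ))
    (by
      refine f.continuous.div (by fun_prop) fun x => ?_
      have : 0 < √(1 + ‖f x‖ ^ 2) := Real.sqrt_pos.mpr (by positivity)
      exact_mod_cast this.ne')
    1
    (fun x => by
      have h0 : 0 < √(1 + ‖f x‖ ^ 2) := Real.sqrt_pos.mpr (by positivity)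
      rw [norm_div, Complex.norm_real, Real.norm_of_nonneg h0.le, div_le_one h0]
      exact Real.le_sqrt_of_sq_le (by linarith))

/-- A ⋆-homomorphism `π : C₀(X) → 𝓛(E)` is non-degenerate if `π(C₀(X)) E` has dense span. -/
def IsNondegenerate (π : C₀(X, ℂ) →⋆ₙₐ[ℂ] Adjointable A E) : Prop :=
  Dense (Submodule.span ℂ {w : E | ∃ (g : C₀(X, ℂ)) (v : E), w = (π g).1 v} : Set E)

open Classical in
/-- The extension of a non-degenerate `π` to `M(C₀(X)) = C_b(X)`: the operator `y ∈ 𝓛(E)`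
determined by `y π(g) v = π(m g) v`. -/
def multiplierExt (π : C₀(X, ℂ) →⋆ₙₐ[ℂ] Adjointable A E) (m : BoundedContinuousFunction X ℂ) :
    Adjointable A E :=
  if h : ∃ y : Adjointable A E, ∀ (g : C₀(X, ℂ)) (v : E), y.1 ((π g).1 v) = (π (bcfMul m g)).1 v
  then h.choose else 0

/-- The image `π(f)` of a continuous function `f` on `X` under a non-degenerate `π`: the regular
operator whose `z`-transform is the image under `π` of the `z`-transform of `f`. -/
def affiliatedImage (π : C₀(X, ℂ) →⋆ₙₐ[ℂ] Adjointable A E) (f : C(X, ℂ)) : E →ₗ.[ℂ] E :=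
  ofZTransform (multiplierExt π (zFun f))

/-- The identity function `ι_G` on a subset `G` of the plane. -/
def idFun (G : Set ℂ) : C(G, ℂ) := ⟨Subtype.val, continuous_subtype_val⟩

/-- The restriction of a continuous function on `H` to a subset `G ⊆ H`. -/
def restrictTo {G H : Set ℂ} (h : G ⊆ H) (f : C(H, ℂ)) : C(G, ℂ) :=
  f.comp ⟨Set.inclusion h, continuous_inclusion h⟩

/-- `π` is a non-degenerate ⋆-homomorphism `C₀(G) → 𝓛(E)` with `π(ι_G) = T`. -/
def IsCalculus {G : Set ℂ} (T : E →ₗ.[ℂ] E) (π : C₀(G, ℂ) →⋆ₙₐ[ℂ] Adjointable A E) : Prop :=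
  IsNondegenerate π ∧ affiliatedImage π (idFun G) = T

variable (A)

open Classical in
/-- The functional calculus `ψ_T : C₀(σ(T)) → 𝓛(E)` of a normal regular operator: the injective
non-degenerate ⋆-homomorphism with `ψ_T(ι) = T`. -/
def stdCalculus (T : E →ₗ.[ℂ] E) : C₀(opSpectrum A T, ℂ) →⋆ₙₐ[ℂ] Adjointable A E :=
  if h : ∃ ψ : C₀(opSpectrum A T, ℂ) →⋆ₙₐ[ℂ] Adjointable A E,
    IsCalculus T ψ ∧ Function.Injective ψ
  then h.choose else 0

/-- The usual functional calculus `f(T) = ψ_T(f)` for `f ∈ C(σ(T))`. -/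
def stdFun (T : E →ₗ.[ℂ] E) (f : C(opSpectrum A T, ℂ)) : E →ₗ.[ℂ] E :=
  affiliatedImage (stdCalculus A T) f

/-- `K` is a finite set of points `c` for which `T - c 1` is invertible, and `σ(T) \ K ⊆ D`. -/
def IsAdmissible (T : E →ₗ.[ℂ] E) (D : Set ℂ) (K : Finset ℂ) : Prop :=
  (∀ c ∈ K, IsInvertible A (subScalar T c)) ∧ opSpectrum A T \ K ⊆ D

/-- A continuous function with domain `D ⊆ ℂ` is compatible with `T` if it is defined on
`σ(T) \ K` for some finite set `K` of points `c` for which `T - c 1` is invertible. -/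
def IsCompatibleDomain (T : E →ₗ.[ℂ] E) (D : Set ℂ) : Prop :=
  ∃ K : Finset ℂ, IsAdmissible A T D K

/-- `G` is almost closed if `G ∪ K` is closed for some finite set `K`. -/
def IsAlmostClosed (G : Set ℂ) : Prop := ∃ K : Finset ℂ, IsClosed (G ∪ K)

/-- A set is compatible with `T` if it is almost closed and contains `σ(T) \ K` for some finite set
`K` of points `c` for which `T - c 1` is invertible. -/
def IsCompatibleSet (T : E →ₗ.[ℂ] E) (G : Set ℂ) : Prop :=
  IsAlmostClosed G ∧ ∃ K : Finset ℂ, IsAdmissible A T G K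

open Classical in
/-- The extended functional calculus `f(T)` for a continuous function `f` with domain `D` that is
compatible with `T`: take an admissible `K` and the ⋆-homomorphism `π` on `C₀(σ(T) \ K)` with
`π(ι) = T`, and put `f(T) = π(f)`, with `f` restricted to `σ(T) \ K`. -/
def extFun (T : E →ₗ.[ℂ] E) {D : Set ℂ} (f : C(D, ℂ)) : E →ₗ.[ℂ] E :=
  if h : ∃ (K : Finset ℂ) (_ : IsAdmissible A T D K)
      (π : C₀((opSpectrum A T \ K : Set ℂ), ℂ) →⋆ₙₐ[ℂ] Adjointable A E), IsCalculus T π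
  then affiliatedImage h.choose_spec.choose_spec.choose
    (restrictTo h.choose_spec.choose.2 f)
  else 0

end Calculus

end HilbertModule

end

open scoped ZeroAtInfty

noncomputable section

namespace HilbertModule

section Basic

variable {A E : Type*} [NonUnitalCStarAlgebra A] [PartialOrder A] [StarOrderedRing A]
  [NormedAddCommGroup E] [NormedSpace ℂ E] [SMul A E] [CStarModule A E]

theorem val_sub (S T : Adjointable A E) (x : E) : (S - T).1 x = S.1 x - T.1 x := rfl

theorem val_one (x : E) : (1 : Adjointable A E).1 x = x := rfl

theorem val_zero (x : E) : (0 : Adjointable A E).1 x = 0 := rfl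

theorem Adjointable.ext {S T : Adjointable A E} (h : ∀ x, S.1 x = T.1 x) : S = T :=
  Subtype.ext (ContinuousLinearMap.ext h)

theorem Adjointable.ext_of_dense {S T : Adjointable A E} {s : Set E} (hs : Dense s)
    (h : ∀ x ∈ s, S.1 x = T.1 x) : S = T :=
  Subtype.ext (DFunLike.coe_injective (Continuous.ext_on hs S.1.continuous T.1.continuous h))

theorem norm_le_of_inner_le {x y : E} (h : inner A x x ≤ inner A y y) : ‖x‖ ≤ ‖y‖ := by
  refine le_of_sq_le_sq ?_ (norm_nonneg _)
  rw [CStarModule.norm_sq_eq A, CStarModule.norm_sq_eq A]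
  exact CStarAlgebra.norm_le_norm_of_nonneg_of_le CStarModule.inner_self_nonneg h

theorem eq_of_dense_inner {s : Set E} (hs : Dense s) {v w : E}
    (h : ∀ x ∈ s, inner A x v = inner A x w) : v = w := by
  refine eq_of_forall_inner (A := A) fun x => ?_
  have hc : ∀ u : E, Continuous fun x : E => inner A x u := fun u =>
    CStarModule.continuous_inner.comp (Continuous.prodMk continuous_id continuous_const)
  exact congrFun (Continuous.ext_on hs (hc v) (hc w) h) x

/-- Two linear maps with the same quadratic form have the same sesquilinear form. -/
theorem inner_eq_of_inner_self_eq {V : Type*} [AddCommGroup V] [Module ℂ V] (a b : V →ₗ[ℂ] E)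
    (h : ∀ v, inner A (a v) (a v) = inner A (b v) (b v)) (v w : V) :
    inner A (a v) (a w) = inner A (b v) (b w) := by
  have h1 := h (v + w)
  have h2 := h (v + Complex.I • w)
  simp only [map_add, map_smul, CStarModule.inner_add_left, CStarModule.inner_add_right,
    CStarModule.inner_smul_left_complex, CStarModule.inner_smul_right_complex, h v, h w] at h1 h2
  have e1 : (inner A (a v) (a w) - inner A (b v) (b w)) +
      (inner A (a w) (a v) - inner A (b w) (b v)) = 0 := by
    rw [← sub_eq_zero] at h1
    rw [← h1]; abel
  have e2 : Complex.I • ((inner A (a v) (a w) - inner A (b v) (b w)) -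
      (inner A (a w) (a v) - inner A (b w) (b v))) = 0 := by
    rw [← sub_eq_zero] at h2
    rw [← h2]
    simp only [smul_sub, smul_add, Complex.star_def, Complex.conj_I, neg_smul]
    abel
  have e3 := (smul_eq_zero.mp e2).resolve_left Complex.I_ne_zero
  have e4 : (2 : ℂ) • (inner A (a v) (a w) - inner A (b v) (b w)) = 0 := by
    rw [two_smul]
    nth_rw 1 [← add_zero (inner A (a v) (a w) - inner A (b v) (b w))]
    rw [sub_eq_zero.mp e3] at e1 ⊢
    simpa using e1
  exact sub_eq_zero.mp ((smul_eq_zero.mp e4).resolve_left two_ne_zero)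

theorem map_smul_adjointable (S : Adjointable A E) (a : A) (x : E) :
    S.1 (a • x) = a • S.1 x := by
  refine eq_of_forall_inner (A := A) fun y => ?_
  rw [inner_apply_right, CStarModule.inner_op_smul_right, CStarModule.inner_op_smul_right,
    inner_apply_right]

/-- A pair of mutually adjoint bounded operators given on dense subspaces extends to an adjointable
operator and its adjoint. -/
theorem exists_adjointable_extension [CompleteSpace E] {V W : Type*} [AddCommGroup V] [Module ℂ V]
    [AddCommGroup W] [Module ℂ W] {e f : V →ₗ[ℂ] E} {e' g : W →ₗ[ℂ] E} (he : DenseRange e)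
    (he' : DenseRange e') {C : ℝ} (hf : ∀ v, ‖f v‖ ≤ C * ‖e v‖)
    (hfg : ∀ v w, inner A (f v) (e' w) = inner A (e v) (g w)) :
    ∃ S : Adjointable A E, (∀ v, S.1 (e v) = f v) ∧ ∀ w, (star S).1 (e' w) = g w := by
  have h1 : ∀ v, f.extendOfNorm e (e v) = f v := LinearMap.extendOfNorm_eq he ⟨C, hf⟩
  have hg : ∀ w, ‖g w‖ ≤ |C| * ‖e' w‖ := by
    intro w
    have hp : ∀ p : E, ‖inner A p (g w)‖ ≤ C * ‖p‖ * ‖e' w‖ := by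
      intro p
      induction p using he.induction_on with
      | hp =>
        have hc : Continuous fun p : E => inner A p (g w) :=
          CStarModule.continuous_inner.comp (Continuous.prodMk continuous_id continuous_const)
        exact isClosed_le hc.norm (by fun_prop)
      | ih v =>
        rw [← hfg]
        exact (CStarModule.norm_inner_le E).trans (by gcongr; exact hf v)
    have h := hp (g w)
    rw [← CStarModule.norm_sq_eq A] at h
    rcases eq_or_ne (g w) 0 with h0 | h0
    · rw [h0, norm_zero]; positivity
    · have hpos := norm_pos_iff.mpr h0
      have : ‖g w‖ ≤ C * ‖e' w‖ := by nlinarith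
      exact this.trans (by gcongr; exact le_abs_self C)
  have h2 : ∀ w, g.extendOfNorm e' (e' w) = g w := LinearMap.extendOfNorm_eq he' ⟨|C|, hg⟩
  have hadj : ∀ x y, inner A (f.extendOfNorm e x) y = inner A x (g.extendOfNorm e' y) := by
    intro x y
    refine congrFun (Continuous.ext_on (he.prodMap he') (f := fun p : E × E =>
      inner A (f.extendOfNorm e p.1) p.2) (g := fun p => inner A p.1 (g.extendOfNorm e' p.2))
      ?_ ?_ ?_) (x, y)
    · exact CStarModule.continuous_inner.comp
        (((f.extendOfNorm e).continuous.comp continuous_fst).prodMk continuous_snd)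
    · exact CStarModule.continuous_inner.comp
        (continuous_fst.prodMk ((g.extendOfNorm e').continuous.comp continuous_snd))
    · rintro _ ⟨⟨v, w⟩, rfl⟩
      simp [h1, h2, hfg]
  let S : Adjointable A E := ⟨f.extendOfNorm e, g.extendOfNorm e', hadj⟩
  refine ⟨S, h1, fun w => ?_⟩
  rw [← h2]
  refine eq_of_forall_inner (A := A) fun x => ?_
  rw [← inner_apply_left]
  exact hadj _ _

theorem injective_of_dense_range {S : Adjointable A E} (hS : IsSelfAdjoint S)
    (hd : DenseRange S.1) {x : E} (hx : S.1 x = 0) : x = 0 := by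
  refine eq_of_dense_inner (A := A) hd ?_
  rintro _ ⟨y, rfl⟩
  rw [inner_apply_left, hS.star_eq, hx, CStarModule.inner_zero_right, CStarModule.inner_zero_right]

theorem denseRange_of_mul {S T : Adjointable A E} (h : DenseRange (S * T).1) : DenseRange S.1 :=
  Dense.mono (by rintro _ ⟨x, rfl⟩; exact ⟨T.1 x, rfl⟩) h

theorem denseRange_mul {S T : Adjointable A E} (hS : DenseRange S.1) (hT : DenseRange T.1) :
    DenseRange (S * T).1 := by
  have h : DenseRange (S.1 ∘ T.1) := DenseRange.comp hS hT S.1.continuous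
  exact h

theorem denseRange_of_isUnit {S : Adjointable A E} (h : IsUnit S) : DenseRange S.1 := by
  obtain ⟨V, hV⟩ := h.exists_right_inv
  refine Function.Surjective.denseRange fun y => ⟨V.1 y, ?_⟩
  rw [← val_mul, hV, val_one]

variable [CompleteSpace E]

theorem cfc_sqrt_of_mul_self {a r : Adjointable A E} (ha : IsSelfAdjoint a)
    (hpos : ∀ t ∈ spectrum ℝ a, 0 ≤ t) (h : a * a = r) : cfc Real.sqrt r = a := by
  have hr : r = cfc (fun t : ℝ => t * t) a := by
    rw [cfc_mul (fun t : ℝ => t) (fun t => t) a, cfc_id' ℝ a, h]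
  rw [hr, ← cfc_comp (R := ℝ) Real.sqrt (fun t => t * t) a ha (by fun_prop) (by fun_prop)]
  calc _ = cfc (fun t : ℝ => t) a := cfc_congr fun t ht => by
        simp [Real.sqrt_mul_self (hpos t ht)]
    _ = a := cfc_id' ℝ a

theorem cfc_sqrt_mul_self {r : Adjointable A E} (hr : IsSelfAdjoint r)
    (hpos : ∀ t ∈ spectrum ℝ r, 0 ≤ t) : cfc Real.sqrt r * cfc Real.sqrt r = r := by
  rw [← cfc_mul (R := ℝ) Real.sqrt Real.sqrt r (by fun_prop) (by fun_prop)]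
  calc _ = cfc (fun t : ℝ => t) r := cfc_congr fun t ht => Real.mul_self_sqrt (hpos t ht)
    _ = r := cfc_id' ℝ r

theorem isSelfAdjoint_cfc_sqrt (r : Adjointable A E) : IsSelfAdjoint (cfc Real.sqrt r) :=
  cfc_predicate _ _

theorem spectrum_nonneg_of_inner_nonneg {a : Adjointable A E} (ha : IsSelfAdjoint a)
    (hpos : ∀ x : E, 0 ≤ inner A x (a.1 x)) : ∀ t ∈ spectrum ℝ a, 0 ≤ t := by
  set n := cfc (fun t : ℝ => max (-t) 0) a with hn
  set c := cfc (fun t : ℝ => √(max (-t) 0 ^ 3)) a with hc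
  have hns : star n = n := (cfc_predicate (R := ℝ) _ a : IsSelfAdjoint n).star_eq
  have hcs : star c = c := (cfc_predicate (R := ℝ) _ a : IsSelfAdjoint c).star_eq
  have hcc : c * c = -(n * (a * n)) := by
    have h1 : n * (a * n) = cfc (fun t : ℝ => max (-t) 0 * (t * max (-t) 0)) a := by
      rw [cfc_mul (fun t : ℝ => max (-t) 0) (fun t : ℝ => t * max (-t) 0) a
        (by fun_prop) (by fun_prop), cfc_mul (fun t : ℝ => t) (fun t : ℝ => max (-t) 0) a
        (by fun_prop) (by fun_prop), cfc_id' ℝ a]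
    rw [h1, ← cfc_neg, hc, ← cfc_mul (R := ℝ) _ _ a (by fun_prop) (by fun_prop)]
    refine cfc_congr fun t _ => ?_
    simp only [Real.mul_self_sqrt (pow_nonneg (le_max_right (-t) 0) 3)]
    rcases le_total (-t) 0 with h | h
    · simp [max_eq_right h]
    · rw [max_eq_left h]; ring
  have hc0 : c = 0 := by
    refine Adjointable.ext fun x => ?_
    have h1 : inner A (c.1 x) (c.1 x) = -inner A (n.1 x) (a.1 (n.1 x)) := by
      rw [inner_apply_left, hcs, ← val_mul, hcc, inner_apply_left, hns,
        ← CStarModule.inner_neg_right]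
      rfl
    have h2 : inner A (c.1 x) (c.1 x) ≤ 0 := by
      rw [h1]; exact neg_nonpos.mpr (hpos _)
    rw [val_zero]
    exact CStarModule.inner_self.mp (le_antisymm h2 CStarModule.inner_self_nonneg)
  intro t ht
  have hmem : √(max (-t) 0 ^ 3) ∈ spectrum ℝ c := by
    rw [hc, cfc_map_spectrum (fun t : ℝ => √(max (-t) 0 ^ 3)) a ha (by fun_prop)]
    exact ⟨t, ht, rfl⟩
  rw [hc0] at hmem
  have h0 : √(max (-t) 0 ^ 3) = 0 := by
    by_contra hne
    refine hmem ?_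
    rw [spectrum.mem_resolventSet_iff, sub_zero]
    exact (isUnit_iff_ne_zero.mpr hne).map _
  by_contra! hlt
  have : 0 < √(max (-t) 0 ^ 3) := Real.sqrt_pos.mpr (by
    have : 0 < max (-t) 0 := lt_max_of_lt_left (by linarith)
    positivity)
  exact this.ne' h0

end Basic

section Multiplier

variable {A E : Type*} [NonUnitalCStarAlgebra A] [PartialOrder A] [StarOrderedRing A]
  [NormedAddCommGroup E] [NormedSpace ℂ E] [SMul A E] [CStarModule A E] [CompleteSpace E]
  {X : Type*} [TopologicalSpace X]

@[simp] theorem bcfMul_apply (m : BoundedContinuousFunction X ℂ) (g : C₀(X, ℂ)) (x : X) :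
    bcfMul m g x = m x * g x := rfl

/-- The linear combination `∑ π(m g) v` indexed by formal combinations of pairs `(g, v)`. -/
def mulCombination (π : C₀(X, ℂ) →⋆ₙₐ[ℂ] Adjointable A E) (m : BoundedContinuousFunction X ℂ) :
    (C₀(X, ℂ) × E →₀ ℂ) →ₗ[ℂ] E :=
  Finsupp.linearCombination ℂ fun p => (π (bcfMul m p.1)).1 p.2

theorem mulCombination_single (π : C₀(X, ℂ) →⋆ₙₐ[ℂ] Adjointable A E)
    (m : BoundedContinuousFunction X ℂ) (g : C₀(X, ℂ)) (v : E) (c : ℂ) :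
    mulCombination π m (Finsupp.single (g, v) c) = c • (π (bcfMul m g)).1 v := by
  simp [mulCombination]

theorem bcfMul_one (g : C₀(X, ℂ)) : bcfMul 1 g = g := by
  ext x; simp

theorem denseRange_mulCombination_one {π : C₀(X, ℂ) →⋆ₙₐ[ℂ] Adjointable A E}
    (hπ : IsNondegenerate π) : DenseRange (mulCombination π 1) := by
  have : Set.range (mulCombination π 1) =
      (Submodule.span ℂ {w : E | ∃ (g : C₀(X, ℂ)) (v : E), w = (π g).1 v} : Set E) := by
    rw [← LinearMap.coe_range, mulCombination, Finsupp.range_linearCombination]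
    congr 2
    ext w
    simp only [Set.mem_range, Prod.exists, Set.mem_ofPred_eq, bcfMul_one, eq_comm]
  rw [DenseRange, this]
  exact hπ

theorem mulCombination_sub_mul (π : C₀(X, ℂ) →⋆ₙₐ[ℂ] Adjointable A E) (c : ℂ)
    (m : BoundedContinuousFunction X ℂ) (u : C₀(X, ℂ) × E →₀ ℂ) :
    mulCombination π (c • 1 - m) u = c • mulCombination π 1 u - mulCombination π m u := by
  induction u using Finsupp.induction_linear with
  | zero => simp
  | add u v hu hv => simp only [map_add, hu, hv, smul_add]; abel
  | single p a =>
    obtain ⟨g, v⟩ := p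
    have : bcfMul (c • 1 - m) g = c • bcfMul 1 g - bcfMul m g := by
      ext x; simp [sub_mul]
    rw [mulCombination_single, mulCombination_single, mulCombination_single, this, map_sub,
      map_smul, val_sub, val_smul, smul_sub, smul_comm]

theorem inner_mulCombination (π : C₀(X, ℂ) →⋆ₙₐ[ℂ] Adjointable A E)
    (m n : BoundedContinuousFunction X ℂ) (u v : C₀(X, ℂ) × E →₀ ℂ) :
    inner A (mulCombination π m u) (mulCombination π n v) =
      inner A (mulCombination π 1 u) (mulCombination π (star m * n) v) := by
  induction u using Finsupp.induction_linear with
  | zero => simp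
  | add u u' hu hu' => simp only [map_add, CStarModule.inner_add_left, hu, hu']
  | single p a =>
    induction v using Finsupp.induction_linear with
    | zero => simp
    | add v v' hv hv' => simp only [map_add, CStarModule.inner_add_right, hv, hv']
    | single q b =>
      obtain ⟨g, x⟩ := p
      obtain ⟨h, y⟩ := q
      have : star (bcfMul m g) * bcfMul n h = star (bcfMul 1 g) * bcfMul (star m * n) h := by
        ext t
        simp
        ring
      simp only [mulCombination_single, CStarModule.inner_smul_left_complex,
        CStarModule.inner_smul_right_complex, inner_apply_left, ← val_mul, ← map_star, ← map_mul,
        this]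

theorem norm_mulCombination_le (π : C₀(X, ℂ) →⋆ₙₐ[ℂ] Adjointable A E)
    (m : BoundedContinuousFunction X ℂ) (u : C₀(X, ℂ) × E →₀ ℂ) :
    ‖mulCombination π m u‖ ≤ ‖m‖ * ‖mulCombination π 1 u‖ := by
  let b : BoundedContinuousFunction X ℂ := BoundedContinuousFunction.ofNormedAddCommGroup
    (fun x => ((√(‖m‖ ^ 2 - ‖m x‖ ^ 2) : ℝ) : ℂ)) (by fun_prop) ‖m‖ (fun x => by
      rw [Complex.norm_real, Real.norm_of_nonneg (Real.sqrt_nonneg _)]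
      exact Real.sqrt_le_iff.mpr ⟨norm_nonneg _, by nlinarith [norm_nonneg (m x)]⟩)
  have hb : star b * b = ((‖m‖ ^ 2 : ℝ) : ℂ) • 1 - star m * m := by
    ext x
    have h1 : 0 ≤ ‖m‖ ^ 2 - ‖m x‖ ^ 2 := by
      nlinarith [norm_nonneg (m x), m.norm_coe_le_norm x]
    have h2 : b x = ((√(‖m‖ ^ 2 - ‖m x‖ ^ 2) : ℝ) : ℂ) := rfl
    have h3 : (starRingEnd ℂ) (m x) * m x = ((‖m x‖ ^ 2 : ℝ) : ℂ) := by
      rw [mul_comm, Complex.mul_conj, Complex.normSq_eq_norm_sq]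
    simp only [BoundedContinuousFunction.coe_mul, BoundedContinuousFunction.coe_star,
      Pi.mul_apply, Pi.star_apply, BoundedContinuousFunction.coe_sub, Pi.sub_apply,
      BoundedContinuousFunction.coe_smul, BoundedContinuousFunction.coe_one, Pi.one_apply,
      smul_eq_mul, mul_one, Complex.star_def, h2, h3, Complex.conj_ofReal]
    rw [← Complex.ofReal_mul, Real.mul_self_sqrt h1, Complex.ofReal_sub]
  have key : inner A (mulCombination π b u) (mulCombination π b u) =
      ((‖m‖ ^ 2 : ℝ) : ℂ) • inner A (mulCombination π 1 u) (mulCombination π 1 u) -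
        inner A (mulCombination π m u) (mulCombination π m u) := by
    rw [inner_mulCombination π b b, hb, mulCombination_sub_mul, CStarModule.inner_sub_right,
      CStarModule.inner_smul_right_complex, inner_mulCombination π m m]
  have hle : inner A (mulCombination π m u) (mulCombination π m u) ≤
      inner A ((‖m‖ : ℂ) • mulCombination π 1 u) ((‖m‖ : ℂ) • mulCombination π 1 u) := by
    rw [CStarModule.inner_smul_left_complex, CStarModule.inner_smul_right_complex, smul_smul,
      Complex.star_def, Complex.conj_ofReal, ← Complex.ofReal_mul, ← sq, ← sub_nonneg, ← key]
    exact CStarModule.inner_self_nonneg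
  have := norm_le_of_inner_le hle
  rwa [norm_smul, Complex.norm_real, Real.norm_of_nonneg (norm_nonneg _)] at this

theorem multiplierExt_apply {π : C₀(X, ℂ) →⋆ₙₐ[ℂ] Adjointable A E} (hπ : IsNondegenerate π)
    (m : BoundedContinuousFunction X ℂ) (g : C₀(X, ℂ)) (v : E) :
    (multiplierExt π m).1 ((π g).1 v) = (π (bcfMul m g)).1 v := by
  have h : ∃ y : Adjointable A E, ∀ (g : C₀(X, ℂ)) (v : E),
      y.1 ((π g).1 v) = (π (bcfMul m g)).1 v := by
    have hd := denseRange_mulCombination_one hπ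
    obtain ⟨S, hS, -⟩ := exists_adjointable_extension (A := A) hd hd (norm_mulCombination_le π m)
      (g := mulCombination π (star m)) fun u v => by
        rw [inner_mulCombination, mul_one]
    refine ⟨S, fun g v => ?_⟩
    have := hS (Finsupp.single (g, v) 1)
    rwa [mulCombination_single, mulCombination_single, bcfMul_one, one_smul, one_smul] at this
  rw [multiplierExt, dif_pos h]
  exact h.choose_spec g v

theorem ext_of_isNondegenerate {π : C₀(X, ℂ) →⋆ₙₐ[ℂ] Adjointable A E} (hπ : IsNondegenerate π)
    {S T : Adjointable A E} (h : ∀ g v, S.1 ((π g).1 v) = T.1 ((π g).1 v)) : S = T := by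
  refine Adjointable.ext_of_dense hπ fun x hx => ?_
  induction hx using Submodule.span_induction with
  | mem x hx => obtain ⟨g, v, rfl⟩ := hx; exact h g v
  | zero => simp
  | add x y _ _ hx hy => rw [map_add, map_add, hx, hy]
  | smul c x _ hx => rw [map_smul, map_smul, hx]

theorem multiplierExt_eq {π : C₀(X, ℂ) →⋆ₙₐ[ℂ] Adjointable A E} (hπ : IsNondegenerate π)
    {m : BoundedContinuousFunction X ℂ} {S : Adjointable A E}
    (h : ∀ g v, S.1 ((π g).1 v) = (π (bcfMul m g)).1 v) : multiplierExt π m = S :=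
  ext_of_isNondegenerate hπ fun g v => by rw [multiplierExt_apply hπ, h]

/-- The extension of a non-degenerate ⋆-homomorphism to bounded functions, as a unital
⋆-homomorphism. -/
def multiplierHom {π : C₀(X, ℂ) →⋆ₙₐ[ℂ] Adjointable A E} (hπ : IsNondegenerate π) :
    BoundedContinuousFunction X ℂ →⋆ₐ[ℂ] Adjointable A E where
  toFun := multiplierExt π
  map_one' := multiplierExt_eq hπ fun g v => by rw [bcfMul_one, val_one]
  map_mul' m n := multiplierExt_eq hπ fun g v => by
    rw [val_mul, multiplierExt_apply hπ, multiplierExt_apply hπ]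
    congr 3; ext x; simp [mul_assoc]
  map_zero' := multiplierExt_eq hπ fun g v => by
    have : bcfMul 0 g = 0 := by ext x; simp
    rw [this, map_zero, val_zero]; rfl
  map_add' m n := multiplierExt_eq hπ fun g v => by
    have : bcfMul (m + n) g = bcfMul m g + bcfMul n g := by ext x; simp [add_mul]
    rw [val_add, multiplierExt_apply hπ, multiplierExt_apply hπ, this, map_add, val_add]
  commutes' c := multiplierExt_eq hπ fun g v => by
    have : bcfMul (algebraMap ℂ _ c) g = c • g := by
      ext x; simp
    rw [this, map_smul, Algebra.algebraMap_eq_smul_one, val_smul, val_smul, val_one]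
  map_star' m := multiplierExt_eq hπ fun g v => by
    refine eq_of_dense_inner (A := A) (denseRange_mulCombination_one hπ) ?_
    rintro _ ⟨u, rfl⟩
    induction u using Finsupp.induction_linear with
    | zero => simp
    | add u u' hu hu' => simp only [map_add, CStarModule.inner_add_left, hu, hu']
    | single p a =>
      obtain ⟨h, y⟩ := p
      have : star (bcfMul m h) * g = star h * bcfMul (star m) g := by
        ext t; simp; ring
      rw [mulCombination_single, bcfMul_one, ← inner_apply_left,
        CStarModule.inner_smul_left_complex, map_smul, CStarModule.inner_smul_left_complex,
        multiplierExt_apply hπ, inner_apply_left, inner_apply_left, ← map_star, ← map_star,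
        ← val_mul, ← val_mul, ← map_mul, ← map_mul, this]

theorem multiplierHom_coe {π : C₀(X, ℂ) →⋆ₙₐ[ℂ] Adjointable A E} (hπ : IsNondegenerate π)
    (m : BoundedContinuousFunction X ℂ) : multiplierHom hπ m = multiplierExt π m := rfl

theorem multiplierHom_toBCF {π : C₀(X, ℂ) →⋆ₙₐ[ℂ] Adjointable A E} (hπ : IsNondegenerate π)
    (g : C₀(X, ℂ)) : multiplierHom hπ g.toBCF = π g :=
  multiplierExt_eq hπ fun h v => by
    rw [← val_mul, ← map_mul]; congr 3

/-- If `b` has no zeros, then `b C₀(X)` is dense in `C₀(X)`. -/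
theorem exists_norm_sub_bcfMul_le {b : BoundedContinuousFunction X ℂ} (hb : ∀ x, b x ≠ 0)
    (g : C₀(X, ℂ)) {ε : ℝ} (hε : 0 < ε) : ∃ h : C₀(X, ℂ), ‖g - bcfMul b h‖ ≤ ε := by
  obtain ⟨K, hK, hgK⟩ : ∃ K : Set X, IsCompact K ∧ ∀ x ∉ K, ‖g x‖ < ε := by
    have h1 := (tendsto_order.1 (tendsto_zero_iff_norm_tendsto_zero.mp g.zero_at_infty')).2 ε hε
    obtain ⟨K, hK, hKs⟩ := Filter.mem_cocompact.mp h1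
    exact ⟨K, hK, fun x hx => hKs hx⟩
  obtain ⟨η, hη, hηK⟩ : ∃ η : ℝ, 0 < η ∧ ∀ x ∈ K, η ≤ ‖b x‖ ^ 2 := by
    rcases K.eq_empty_or_nonempty with rfl | hne
    · exact ⟨1, one_pos, by simp⟩
    · obtain ⟨x, hx, hmin⟩ := hK.exists_isMinOn hne
        (f := fun x => ‖b x‖ ^ 2) (by fun_prop)
      exact ⟨‖b x‖ ^ 2, pow_pos (norm_pos_iff.mpr (hb x)) 2, fun y hy => hmin hy⟩
  set δ : ℝ := η * ε / (‖g‖ + 1) with hδ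
  have hg1 : 0 < ‖g‖ + 1 := by positivity
  have hδ0 : 0 < δ := by positivity
  have hpos : ∀ x, 0 < ‖b x‖ ^ 2 + δ := fun x => by positivity
  let c : BoundedContinuousFunction X ℂ := BoundedContinuousFunction.ofNormedAddCommGroup
    (fun x => star (b x) / ((‖b x‖ ^ 2 + δ : ℝ) : ℂ))
    (by
      refine Continuous.div (by fun_prop) (by fun_prop) fun x => ?_
      exact_mod_cast (hpos x).ne')
    (‖b‖ / δ)
    (fun x => by
      rw [norm_div, norm_star, Complex.norm_real, Real.norm_of_nonneg (hpos x).le]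
      gcongr
      · exact b.norm_coe_le_norm x
      · nlinarith [sq_nonneg ‖b x‖])
  refine ⟨bcfMul c g, ?_⟩
  rw [← ZeroAtInftyContinuousMap.norm_toBCF_eq_norm, BoundedContinuousFunction.norm_le hε.le]
  intro x
  have hx : (g - bcfMul b (bcfMul c g)).toBCF x = ((δ / (‖b x‖ ^ 2 + δ) : ℝ) : ℂ) * g x := by
    change g x - b x * (star (b x) / ((‖b x‖ ^ 2 + δ : ℝ) : ℂ) * g x) = _
    have h0 : ((‖b x‖ ^ 2 + δ : ℝ) : ℂ) ≠ 0 := by exact_mod_cast (hpos x).ne'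
    have h1 : b x * star (b x) = ((‖b x‖ ^ 2 : ℝ) : ℂ) := by
      rw [Complex.star_def, Complex.mul_conj, Complex.normSq_eq_norm_sq]
    have h2 : b x * (star (b x) / ((‖b x‖ ^ 2 + δ : ℝ) : ℂ) * g x) =
        (b x * star (b x)) / ((‖b x‖ ^ 2 + δ : ℝ) : ℂ) * g x := by ring
    rw [h2, h1, Complex.ofReal_div]
    field_simp
    push_cast
    ring
  rw [hx, norm_mul, Complex.norm_real, Real.norm_of_nonneg (div_pos hδ0 (hpos x)).le]
  have hgx : ‖g x‖ ≤ ‖g‖ := g.toBCF.norm_coe_le_norm x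
  by_cases hxK : x ∈ K
  · have h1 := hηK x hxK
    rw [div_mul_eq_mul_div, div_le_iff₀ (hpos x)]
    have h2 : δ * (‖g‖ + 1) = η * ε := by rw [hδ]; field_simp
    nlinarith [norm_nonneg (g x)]
  · have h1 := hgK x hxK
    have h2 : δ / (‖b x‖ ^ 2 + δ) ≤ 1 := by
      rw [div_le_one (hpos x)]; nlinarith [sq_nonneg ‖b x‖]
    nlinarith [norm_nonneg (g x)]

/-- If `b` has no zeros, then its image has dense range. -/
theorem denseRange_multiplierHom {π : C₀(X, ℂ) →⋆ₙₐ[ℂ] Adjointable A E} (hπ : IsNondegenerate π)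
    {b : BoundedContinuousFunction X ℂ} (hb : ∀ x, b x ≠ 0) :
    DenseRange (multiplierHom hπ b).1 := by
  suffices h : Dense ((LinearMap.range ((multiplierHom hπ b).1 : E →ₗ[ℂ] E)) : Set E) by
    rwa [LinearMap.coe_range] at h
  rw [Submodule.dense_iff_topologicalClosure_eq_top, eq_top_iff,
    ← Submodule.dense_iff_topologicalClosure_eq_top.mp hπ]
  refine Submodule.topologicalClosure_minimal _ ?_ (Submodule.isClosed_topologicalClosure _)
  rw [Submodule.span_le]
  rintro _ ⟨g, v, rfl⟩
  rw [SetLike.mem_coe, ← SetLike.mem_coe, Submodule.topologicalClosure_coe,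
    Metric.mem_closure_iff]
  intro ε hε
  obtain ⟨h, hh⟩ := exists_norm_sub_bcfMul_le hb g (ε := ε / (‖v‖ + 1)) (by positivity)
  refine ⟨_, ⟨(π h).1 v, rfl⟩, ?_⟩
  rw [dist_eq_norm]
  change ‖(π g).1 v - (multiplierExt π b).1 ((π h).1 v)‖ < ε
  rw [multiplierExt_apply hπ, ← val_sub, ← map_sub]
  calc ‖(π (g - bcfMul b h)).1 v‖ ≤ ‖π (g - bcfMul b h)‖ * ‖v‖ :=
        (π (g - bcfMul b h)).1.le_opNorm v
    _ ≤ ε / (‖v‖ + 1) * ‖v‖ := by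
        gcongr
        exact (NonUnitalStarAlgHom.norm_apply_le π _).trans hh
    _ < ε := by
        rw [div_mul_eq_mul_div, div_lt_iff₀ (by positivity)]
        nlinarith

end Multiplier

section ZTransform

variable {A E : Type*} [NonUnitalCStarAlgebra A] [PartialOrder A] [StarOrderedRing A]
  [NormedAddCommGroup E] [NormedSpace ℂ E] [SMul A E] [CStarModule A E] [CompleteSpace E]

/-- The operator `(1 - z⋆z)^{1/2}`. -/
def zRoot (z : Adjointable A E) : Adjointable A E := cfc Real.sqrt (1 - star z * z)

/-- The operators that occur as `z`-transforms of regular operators: `1 - z⋆z` is positive and its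
square root has dense range. -/
structure IsZTransform (z : Adjointable A E) : Prop where
  sq : zRoot z * zRoot z = 1 - star z * z
  dense : DenseRange (zRoot z).1

theorem isSelfAdjoint_zRoot (z : Adjointable A E) : IsSelfAdjoint (zRoot z) :=
  isSelfAdjoint_cfc_sqrt _

theorem star_zRoot (z : Adjointable A E) : star (zRoot z) = zRoot z :=
  (isSelfAdjoint_zRoot z).star_eq

theorem zRoot_eq {z q : Adjointable A E} (hq : IsSelfAdjoint q)
    (hpos : ∀ t ∈ spectrum ℝ q, 0 ≤ t) (h : q * q = 1 - star z * z) : zRoot z = q :=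
  cfc_sqrt_of_mul_self hq hpos h

theorem IsZTransform.sq_add {z : Adjointable A E} (hz : IsZTransform z) :
    zRoot z * zRoot z + star z * z = 1 := by
  rw [hz.sq, sub_add_cancel]

theorem IsZTransform.sq_add_apply {z : Adjointable A E} (hz : IsZTransform z) (v : E) :
    (zRoot z).1 ((zRoot z).1 v) + (star z).1 (z.1 v) = v := by
  have := congrArg (fun S : Adjointable A E => S.1 v) hz.sq_add
  exact this

theorem IsZTransform.eq_zero {z : Adjointable A E} (hz : IsZTransform z) {v : E}
    (hv : (zRoot z).1 v = 0) : v = 0 :=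
  injective_of_dense_range (isSelfAdjoint_zRoot z) hz.dense hv

theorem IsZTransform.graph_eq {z : Adjointable A E} (hz : IsZTransform z) :
    (ofZTransform z).graph =
      LinearMap.range (((zRoot z).1 : E →ₗ[ℂ] E).prod (z.1 : E →ₗ[ℂ] E)) := by
  refine Submodule.toLinearPMap_graph_eq _ ?_
  rintro _ ⟨v, rfl⟩ hv
  have : v = 0 := hz.eq_zero hv
  simp [this]

theorem IsZTransform.mem_graph_iff {z : Adjointable A E} (hz : IsZTransform z) {p : E × E} :
    p ∈ (ofZTransform z).graph ↔ ∃ v, (zRoot z).1 v = p.1 ∧ z.1 v = p.2 := by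
  rw [hz.graph_eq, LinearMap.mem_range]
  exact exists_congr fun v => Prod.ext_iff

theorem IsZTransform.mem_domain_iff {z : Adjointable A E} (hz : IsZTransform z) {x : E} :
    x ∈ (ofZTransform z).domain ↔ ∃ v, (zRoot z).1 v = x := by
  rw [LinearPMap.mem_domain_iff]
  simp only [hz.mem_graph_iff]
  exact ⟨fun ⟨_, v, h, _⟩ => ⟨v, h⟩, fun ⟨v, h⟩ => ⟨_, v, h, rfl⟩⟩

theorem IsZTransform.apply {z : Adjointable A E} (hz : IsZTransform z) (v : E)
    (x : (ofZTransform z).domain) (hx : (zRoot z).1 v = x) : ofZTransform z x = z.1 v :=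
  LinearPMap.mem_graph_snd_inj _ (LinearPMap.mem_graph _ x)
    (hz.mem_graph_iff.mpr ⟨v, rfl, rfl⟩) hx.symm

theorem IsZTransform.coe_domain {z : Adjointable A E} (hz : IsZTransform z) :
    ((ofZTransform z).domain : Set E) = Set.range (zRoot z).1 := by
  ext x; exact hz.mem_domain_iff

/-- A regular operator determines its `z`-transform. -/
theorem ofZTransform_injective {z z' : Adjointable A E} (hz : IsZTransform z)
    (hz' : IsZTransform z') (h : ofZTransform z = ofZTransform z') : z = z' := by
  have aux : ∀ {y y' : Adjointable A E}, IsZTransform y → IsZTransform y' →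
      ofZTransform y = ofZTransform y' →
      zRoot y' * (zRoot y' * zRoot y + star y' * y) = zRoot y ∧
        y' * (zRoot y' * zRoot y + star y' * y) = y := by
    intro y y' hy hy' h
    have key : ∀ v, ∃ w, (zRoot y').1 w = (zRoot y).1 v ∧ y'.1 w = y.1 v ∧
        (zRoot y' * zRoot y + star y' * y).1 v = w := by
      intro v
      have hv : ((zRoot y).1 v, y.1 v) ∈ (ofZTransform y).graph :=
        hy.mem_graph_iff.mpr ⟨v, rfl, rfl⟩
      rw [h] at hv
      obtain ⟨w, hw1, hw2⟩ := hy'.mem_graph_iff.mp hv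
      simp only at hw1 hw2
      refine ⟨w, hw1, hw2, ?_⟩
      rw [val_add, val_mul, val_mul, ← hw1, ← hw2]
      exact hy'.sq_add_apply w
    constructor <;> refine Adjointable.ext fun v => ?_ <;> obtain ⟨w, h1, h2, h3⟩ := key v
    · rw [val_mul, h3, h1]
    · rw [val_mul, h3, h2]
  obtain ⟨h1, h2⟩ := aux hz hz' h
  obtain ⟨h3, h4⟩ := aux hz' hz h.symm
  set q := zRoot z
  set q' := zRoot z'
  have hq : star q = q := star_zRoot z
  have hq' : star q' = q' := star_zRoot z'
  set u := q' * q + star z' * z with hu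
  have hus : star u = q * q' + star z * z' := by
    rw [hu, star_add, star_mul, star_mul, star_star, hq, hq']
  rw [← hus] at h3 h4
  have huu : u * star u = 1 := by
    have e1 : u * star u = q' * (q * star u) + star z' * (z * star u) := by
      rw [hu]; noncomm_ring
    rw [e1, h3, h4, hz'.sq_add]
  have h5 : star u * q' = q := by
    have := congrArg star h1
    rwa [star_mul, hq', hq] at this
  have hqq : q * q = q' * q' := by
    nth_rw 2 [← h5]
    nth_rw 1 [← h1]
    calc q' * u * (star u * q') = q' * (u * star u) * q' := by noncomm_ring
      _ = _ := by rw [huu, mul_one]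
  have hroot : q = q' := by
    have : 1 - star z * z = 1 - star z' * z' := by rw [← hz.sq, ← hz'.sq]; exact hqq
    change cfc Real.sqrt (1 - star z * z) = cfc Real.sqrt (1 - star z' * z')
    rw [this]
  rw [← hroot] at h5
  refine Adjointable.ext_of_dense hz.dense ?_
  rintro _ ⟨v, rfl⟩
  rw [← val_mul, ← val_mul]
  change (z * q).1 v = (z' * q).1 v
  nth_rw 1 [← h5]
  rw [← mul_assoc, h4]

section Normal

variable {z : Adjointable A E}

theorem zRoot_star (hn : IsStarNormal z) : zRoot (star z) = zRoot z := by
  rw [zRoot, zRoot, star_star, hn.star_comm_self.eq]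

theorem commute_zRoot (hn : IsStarNormal z) : Commute (zRoot z) z := by
  refine Commute.cfc_real ?_ _
  exact (Commute.one_left z).sub_left (hn.star_comm_self.mul_left (Commute.refl z))

theorem commute_zRoot_star (hn : IsStarNormal z) : Commute (zRoot z) (star z) := by
  refine Commute.cfc_real ?_ _
  exact (Commute.one_left _).sub_left ((Commute.refl _).mul_left hn.star_comm_self.symm)

theorem isZTransform_star (hz : IsZTransform z) (hn : IsStarNormal z) : IsZTransform (star z) :=
  ⟨by rw [zRoot_star hn, hz.sq, star_star, hn.star_comm_self.eq], by
    rw [zRoot_star hn]; exact hz.dense⟩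

theorem val_commute {S T : Adjointable A E} (h : Commute S T) (x : E) :
    S.1 (T.1 x) = T.1 (S.1 x) := by
  rw [← val_mul, h.eq, val_mul]

theorem IsZTransform.adjointGraph_eq (hz : IsZTransform z) (hn : IsStarNormal z) :
    adjointGraph A (ofZTransform z) = (ofZTransform (star z)).graph := by
  have hc := val_commute (commute_zRoot hn)
  have hc' := val_commute (commute_zRoot_star hn)
  have hnn : ∀ x, z.1 ((star z).1 x) = (star z).1 (z.1 x) :=
    val_commute hn.star_comm_self.symm
  ext ⟨p, q⟩
  rw [(isZTransform_star hz hn).mem_graph_iff, zRoot_star hn]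
  constructor
  · intro h
    have h1 : (star z).1 p = (zRoot z).1 q := by
      refine eq_of_forall_inner (A := A) fun v => ?_
      have hm : (zRoot z).1 v ∈ (ofZTransform z).domain := hz.mem_domain_iff.mpr ⟨v, rfl⟩
      have := h ⟨_, hm⟩
      rw [hz.apply v _ rfl] at this
      rw [← inner_apply_left, this, inner_apply_left, star_zRoot]
    refine ⟨(zRoot z).1 p + z.1 q, ?_, ?_⟩
    · simp only [map_add]
      rw [hc q, ← h1, hnn]
      exact hz.sq_add_apply p
    · simp only [map_add]
      rw [← hc' p, h1]
      exact hz.sq_add_apply q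
  · rintro ⟨v, hv1, hv2⟩ ⟨x, hx⟩
    obtain ⟨w, rfl⟩ := hz.mem_domain_iff.mp hx
    rw [hz.apply w _ rfl]
    simp only at hv1 hv2 ⊢
    rw [← hv1, ← hv2, inner_apply_left, inner_apply_left, star_zRoot, hc']

theorem IsZTransform.adjoint_eq (hz : IsZTransform z) (hn : IsStarNormal z) :
    adjoint A (ofZTransform z) = ofZTransform (star z) := by
  refine LinearPMap.eq_of_eq_graph ?_
  rw [adjoint, Submodule.toLinearPMap_graph_eq, hz.adjointGraph_eq hn]
  intro p hp h0
  rw [hz.adjointGraph_eq hn] at hp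
  exact LinearPMap.graph_fst_eq_zero_snd _ hp h0

theorem IsZTransform.adjoint_apply (hz : IsZTransform z) (hn : IsStarNormal z) (v : E)
    (x : (adjoint A (ofZTransform z)).domain) (hx : (zRoot z).1 v = x) :
    adjoint A (ofZTransform z) x = (star z).1 v := by
  refine LinearPMap.mem_graph_snd_inj _ (LinearPMap.mem_graph _ x) ?_ hx.symm
  rw [hz.adjoint_eq hn, (isZTransform_star hz hn).mem_graph_iff, zRoot_star hn]
  exact ⟨v, rfl, rfl⟩

theorem IsZTransform.isClosed (hz : IsZTransform z) : (ofZTransform z).IsClosed := by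
  have : ((ofZTransform z).graph : Set (E × E)) =
      {p | (zRoot z).1 ((zRoot z).1 p.1 + (star z).1 p.2) = p.1} ∩
        {p | z.1 ((zRoot z).1 p.1 + (star z).1 p.2) = p.2} := by
    ext ⟨a, b⟩
    rw [SetLike.mem_coe, hz.mem_graph_iff]
    constructor
    · rintro ⟨v, rfl, rfl⟩
      simp only [Set.mem_inter_iff, Set.mem_ofPred_eq, hz.sq_add_apply v, and_self]
    · rintro ⟨h1, h2⟩
      exact ⟨_, h1, h2⟩
  rw [LinearPMap.IsClosed, this]
  exact (isClosed_eq (by fun_prop) (by fun_prop)).inter (isClosed_eq (by fun_prop) (by fun_prop))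

theorem IsZTransform.isRegular (hz : IsZTransform z) (hn : IsStarNormal z) :
    IsRegular A (ofZTransform z) where
  dense_domain := by rw [hz.coe_domain]; exact hz.dense
  smul_mem a x hx := by
    obtain ⟨v, rfl⟩ := hz.mem_domain_iff.mp hx
    exact hz.mem_domain_iff.mpr ⟨a • v, map_smul_adjointable _ _ _⟩
  map_smul a x hx := by
    obtain ⟨v, rfl⟩ := hz.mem_domain_iff.mp hx
    rw [hz.apply v ⟨_, hx⟩ rfl, hz.apply (a • v) _ (map_smul_adjointable _ _ _),
      map_smul_adjointable]
  isClosed := hz.isClosed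
  dense_domain_adjoint := by
    rw [hz.adjoint_eq hn, (isZTransform_star hz hn).coe_domain]
    exact (isZTransform_star hz hn).dense
  dense_range := by
    refine dense_univ.mono fun w _ => ?_
    have hm : (zRoot z).1 ((zRoot z).1 w) ∈ (ofZTransform z).domain :=
      hz.mem_domain_iff.mpr ⟨_, rfl⟩
    have h1 : ofZTransform z ⟨_, hm⟩ = (zRoot z).1 (z.1 w) := by
      rw [hz.apply _ _ rfl, val_commute (commute_zRoot hn)]
    refine ⟨⟨_, hm⟩, ?_⟩
    rw [hz.adjoint_eq hn]
    have h2 : ofZTransform z ⟨_, hm⟩ ∈ (ofZTransform (star z)).domain := by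
      rw [h1, (isZTransform_star hz hn).mem_domain_iff, zRoot_star hn]
      exact ⟨_, rfl⟩
    refine ⟨h2, ?_⟩
    rw [(isZTransform_star hz hn).apply (z.1 w) _ (by rw [zRoot_star hn]; exact h1.symm)]
    exact (hz.sq_add_apply w).symm

theorem IsZTransform.isNormal (hz : IsZTransform z) (hn : IsStarNormal z) :
    IsNormal A (ofZTransform z) := by
  have hd : (ofZTransform z).domain = (adjoint A (ofZTransform z)).domain := by
    ext x
    rw [hz.adjoint_eq hn, hz.mem_domain_iff, (isZTransform_star hz hn).mem_domain_iff,
      zRoot_star hn]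
  refine ⟨hd, fun ⟨x, hx⟩ => ?_⟩
  obtain ⟨v, rfl⟩ := hz.mem_domain_iff.mp hx
  rw [hz.apply v _ rfl, hz.adjoint_apply hn v _ rfl, inner_apply_left,
    inner_apply_left, star_star, val_commute hn.star_comm_self]

end Normal

section Affiliated

variable {X : Type*} [TopologicalSpace X]

/-- The bounded function `(1 + |f|²)^{-1/2}`. -/
def invRootFun (f : C(X, ℂ)) : BoundedContinuousFunction X ℂ :=
  BoundedContinuousFunction.ofNormedAddCommGroup
    (fun x => (((√(1 + ‖f x‖ ^ 2))⁻¹ : ℝ) : ℂ))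
    (by
      refine Complex.continuous_ofReal.comp (Continuous.inv₀ (by fun_prop) fun x => ?_)
      exact (Real.sqrt_pos.mpr (by positivity)).ne')
    1
    (fun x => by
      rw [Complex.norm_real, Real.norm_of_nonneg (by positivity)]
      exact inv_le_one_of_one_le₀ (Real.one_le_sqrt.mpr (by nlinarith [sq_nonneg ‖f x‖])))

theorem invRootFun_apply (f : C(X, ℂ)) (x : X) :
    invRootFun f x = (((√(1 + ‖f x‖ ^ 2))⁻¹ : ℝ) : ℂ) := rfl

theorem zFun_apply (f : C(X, ℂ)) (x : X) : zFun f x = f x * invRootFun f x := by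
  change f x / ((√(1 + ‖f x‖ ^ 2) : ℝ) : ℂ) = _
  rw [invRootFun_apply, Complex.ofReal_inv, div_eq_mul_inv]

theorem star_invRootFun (f : C(X, ℂ)) : star (invRootFun f) = invRootFun f := by
  ext x
  rw [BoundedContinuousFunction.star_apply, invRootFun_apply, Complex.star_def,
    Complex.conj_ofReal]

theorem invRootFun_mul_self (f : C(X, ℂ)) :
    invRootFun f * invRootFun f = 1 - star (zFun f) * zFun f := by
  ext x
  simp only [BoundedContinuousFunction.coe_mul, Pi.mul_apply, BoundedContinuousFunction.coe_sub,
    Pi.sub_apply, BoundedContinuousFunction.coe_one, Pi.one_apply,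
    BoundedContinuousFunction.star_apply, zFun_apply, star_mul]
  have h1 : star (invRootFun f x) = invRootFun f x := by
    rw [invRootFun_apply, Complex.star_def, Complex.conj_ofReal]
  have h2 : star (f x) * f x = ((‖f x‖ ^ 2 : ℝ) : ℂ) := by
    rw [Complex.star_def, mul_comm, Complex.mul_conj, Complex.normSq_eq_norm_sq]
  have h3 : invRootFun f x * invRootFun f x = (((1 + ‖f x‖ ^ 2)⁻¹ : ℝ) : ℂ) := by
    rw [invRootFun_apply, ← Complex.ofReal_mul, ← mul_inv, Real.mul_self_sqrt (by positivity)]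
  rw [h1, show invRootFun f x * star (f x) * (f x * invRootFun f x) =
    star (f x) * f x * (invRootFun f x * invRootFun f x) by ring, h2, h3, ← Complex.ofReal_mul,
    ← Complex.ofReal_one, ← Complex.ofReal_sub]
  congr 1
  have : 1 + ‖f x‖ ^ 2 ≠ 0 := by positivity
  field_simp
  ring

/-- A square root of `(1 + |f|²)^{-1/2}`. -/
theorem exists_star_mul_self_eq_invRootFun (f : C(X, ℂ)) :
    ∃ c : BoundedContinuousFunction X ℂ, star c * c = invRootFun f := by
  refine ⟨BoundedContinuousFunction.ofNormedAddCommGroup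
    (fun x => ((√((√(1 + ‖f x‖ ^ 2))⁻¹) : ℝ) : ℂ))
    (by
      refine Complex.continuous_ofReal.comp
        (Real.continuous_sqrt.comp (Continuous.inv₀ (by fun_prop) fun x => ?_))
      exact (Real.sqrt_pos.mpr (by positivity)).ne')
    1
    (fun x => by
      rw [Complex.norm_real, Real.norm_of_nonneg (by positivity)]
      exact Real.sqrt_le_one.mpr
        (inv_le_one_of_one_le₀ (Real.one_le_sqrt.mpr (by nlinarith [sq_nonneg ‖f x‖])))), ?_⟩
  ext x
  rw [invRootFun_apply]
  change star (((√((√(1 + ‖f x‖ ^ 2))⁻¹) : ℝ) : ℂ)) * ((√((√(1 + ‖f x‖ ^ 2))⁻¹) : ℝ) : ℂ) = _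
  rw [Complex.star_def, Complex.conj_ofReal, ← Complex.ofReal_mul,
    Real.mul_self_sqrt (by positivity)]

variable {π : C₀(X, ℂ) →⋆ₙₐ[ℂ] Adjointable A E} (hπ : IsNondegenerate π) (f : C(X, ℂ))

include hπ

theorem zRoot_multiplierExt :
    zRoot (multiplierExt π (zFun f)) = multiplierExt π (invRootFun f) := by
  simp only [← multiplierHom_coe hπ]
  refine zRoot_eq ?_ ?_ ?_
  · rw [IsSelfAdjoint, ← map_star, star_invRootFun]
  · obtain ⟨c, hc⟩ := exists_star_mul_self_eq_invRootFun f
    rw [← hc, map_mul, map_star]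
    exact spectrum_star_mul_self_nonneg
  · rw [← map_mul, invRootFun_mul_self, map_sub, map_one, map_mul, map_star]

theorem isZTransform_multiplierExt : IsZTransform (multiplierExt π (zFun f)) where
  sq := by
    rw [zRoot_multiplierExt hπ]
    simp only [← multiplierHom_coe hπ]
    rw [← map_mul, invRootFun_mul_self, map_sub, map_one, map_mul, map_star]
  dense := by
    rw [zRoot_multiplierExt hπ]
    refine denseRange_multiplierHom hπ fun x => ?_
    rw [invRootFun_apply]
    have : 0 < √(1 + ‖f x‖ ^ 2) := Real.sqrt_pos.mpr (by positivity)
    exact_mod_cast (inv_pos.mpr this).ne'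

theorem isStarNormal_multiplierExt (m : BoundedContinuousFunction X ℂ) :
    IsStarNormal (multiplierExt π m) := by
  rw [← multiplierHom_coe hπ]
  exact ⟨by rw [commute_iff_eq, ← map_star, ← map_mul, ← map_mul, mul_comm]⟩

theorem isRegular_affiliatedImage : IsRegular A (affiliatedImage π f) :=
  (isZTransform_multiplierExt hπ f).isRegular (isStarNormal_multiplierExt hπ _)

theorem isNormal_affiliatedImage : IsNormal A (affiliatedImage π f) :=
  (isZTransform_multiplierExt hπ f).isNormal (isStarNormal_multiplierExt hπ _)

/-- On `C₀(X)` the affiliated image is `π` itself. -/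
theorem affiliatedImage_toContinuousMap (g : C₀(X, ℂ)) :
    affiliatedImage π g.toContinuousMap = LinearMap.toPMap ((π g).1 : E →ₗ[ℂ] E) ⊤ := by
  have hz := isZTransform_multiplierExt hπ g.toContinuousMap
  have hfac : multiplierExt π (zFun g.toContinuousMap) =
      π g * zRoot (multiplierExt π (zFun g.toContinuousMap)) := by
    rw [zRoot_multiplierExt hπ]
    simp only [← multiplierHom_coe hπ, ← multiplierHom_toBCF hπ]
    rw [← map_mul]
    congr 1
    ext x
    exact zFun_apply _ x
  have hsurj : Function.Surjective (zRoot (multiplierExt π (zFun g.toContinuousMap))).1 := by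
    let r : BoundedContinuousFunction X ℂ := BoundedContinuousFunction.ofNormedAddCommGroup
      (fun x => ((√(1 + ‖g x‖ ^ 2) : ℝ) : ℂ))
      (by have := g.continuous; fun_prop) (√(1 + ‖g‖ ^ 2)) (fun x => by
        rw [Complex.norm_real, Real.norm_of_nonneg (by positivity)]
        gcongr
        exact g.toBCF.norm_coe_le_norm x)
    have h1 : invRootFun g.toContinuousMap * r = 1 := by
      ext x
      change (((√(1 + ‖g x‖ ^ 2))⁻¹ : ℝ) : ℂ) * ((√(1 + ‖g x‖ ^ 2) : ℝ) : ℂ) = 1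
      have : 0 < √(1 + ‖g x‖ ^ 2) := Real.sqrt_pos.mpr (by positivity)
      rw [← Complex.ofReal_mul, inv_mul_cancel₀ this.ne', Complex.ofReal_one]
    intro y
    refine ⟨(multiplierExt π r).1 y, ?_⟩
    rw [zRoot_multiplierExt hπ, ← val_mul]
    simp only [← multiplierHom_coe hπ]
    rw [← map_mul, h1, map_one, val_one]
  refine LinearPMap.eq_of_eq_graph ?_
  ext ⟨a, b⟩
  rw [affiliatedImage, hz.mem_graph_iff, LinearPMap.mem_graph_iff]
  constructor
  · rintro ⟨v, hv1, hv2⟩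
    refine ⟨⟨a, trivial⟩, rfl, ?_⟩
    rw [hfac, val_mul, hv1] at hv2
    exact hv2
  · rintro ⟨x, hx1, hx2⟩
    obtain ⟨v, hv⟩ := hsurj a
    refine ⟨v, hv, ?_⟩
    rw [hfac, val_mul, hv, ← hx2]
    simp only at hx1
    rw [← hx1]
    rfl

end Affiliated

end ZTransform

section RegularToZ

variable {A E : Type*} [NonUnitalCStarAlgebra A] [PartialOrder A] [StarOrderedRing A]
  [NormedAddCommGroup E] [NormedSpace ℂ E] [SMul A E] [CStarModule A E] {T : E →ₗ.[ℂ] E}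

theorem inner_of_mem_adjointGraph {x y v w : E} (hxy : (x, y) ∈ T.graph)
    (hvw : (v, w) ∈ adjointGraph A T) : inner A y v = inner A x w := by
  obtain ⟨u, hu1, hu2⟩ := (LinearPMap.mem_graph_iff T).mp hxy
  simp only at hu1 hu2
  rw [← hu1, ← hu2]
  exact hvw u

theorem adjoint_graph_eq (hd : Dense (T.domain : Set E)) :
    (adjoint A T).graph = adjointGraph A T := by
  refine Submodule.toLinearPMap_graph_eq _ fun p hp h0 => ?_
  refine eq_of_dense_inner (A := A) hd fun x hx => ?_
  have := hp ⟨x, hx⟩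
  rw [h0, CStarModule.inner_zero_right] at this
  rw [← this, CStarModule.inner_zero_right]

theorem isClosed_adjointGraph : IsClosed (adjointGraph A T : Set (E × E)) := by
  have : (adjointGraph A T : Set (E × E)) =
      ⋂ u : T.domain, {p | inner A (T u) p.1 = inner A (u : E) p.2} := by
    ext p
    simp only [Set.mem_iInter]
    rfl
  rw [this]
  refine isClosed_iInter fun u => isClosed_eq ?_ ?_
  · exact CStarModule.continuous_inner.comp (continuous_const.prodMk continuous_fst)
  · exact CStarModule.continuous_inner.comp (continuous_const.prodMk continuous_snd)

variable (A) in
/-- The triples `(x, T x, T⋆T x)`. -/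
def compositeGraph (T : E →ₗ.[ℂ] E) : Submodule ℂ (E × E × E) :=
  T.graph.comap ((LinearMap.fst ℂ E (E × E)).prod
    (LinearMap.fst ℂ E E ∘ₗ LinearMap.snd ℂ E (E × E))) ⊓
  (adjointGraph A T).comap (LinearMap.snd ℂ E (E × E))

theorem mem_compositeGraph {x y s : E} : (x, y, s) ∈ compositeGraph A T ↔
    (x, y) ∈ T.graph ∧ (y, s) ∈ adjointGraph A T := Iff.rfl

variable (A) in
/-- The map `(x, T x, T⋆T x) ↦ x + T⋆T x`. -/
def compositeSum (T : E →ₗ.[ℂ] E) : compositeGraph A T →ₗ[ℂ] E :=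
  (LinearMap.fst ℂ E (E × E) + LinearMap.snd ℂ E E ∘ₗ LinearMap.snd ℂ E (E × E)) ∘ₗ
    (compositeGraph A T).subtype

theorem inner_self_add_of_compositeGraph {x y s : E} (h : (x, y, s) ∈ compositeGraph A T) :
    inner A x (x + s) = inner A x x + inner A y y := by
  obtain ⟨h1, h2⟩ := mem_compositeGraph.mp h
  rw [CStarModule.inner_add_right, inner_of_mem_adjointGraph h1 h2]

theorem norm_le_of_compositeGraph {x y s : E} (h : (x, y, s) ∈ compositeGraph A T) :
    ‖x‖ ≤ ‖x + s‖ ∧ ‖y‖ ≤ ‖x + s‖ := by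
  have h1 := inner_self_add_of_compositeGraph h
  have hx : ‖x‖ ^ 2 ≤ ‖x‖ * ‖x + s‖ := by
    rw [CStarModule.norm_sq_eq A]
    refine le_trans (CStarAlgebra.norm_le_norm_of_nonneg_of_le
      (CStarModule.inner_self_nonneg (E := E))
      (le_add_of_nonneg_right (CStarModule.inner_self_nonneg (x := y)))) ?_
    rw [← h1]
    exact CStarModule.norm_inner_le E
  have hy : ‖y‖ ^ 2 ≤ ‖x‖ * ‖x + s‖ := by
    rw [CStarModule.norm_sq_eq A]
    refine le_trans (CStarAlgebra.norm_le_norm_of_nonneg_of_le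
      (CStarModule.inner_self_nonneg (E := E))
      (le_add_of_nonneg_left (CStarModule.inner_self_nonneg (x := x)))) ?_
    rw [← h1]
    exact CStarModule.norm_inner_le E
  have hx' : ‖x‖ ≤ ‖x + s‖ := by
    rcases (norm_nonneg x).eq_or_lt with h0 | h0
    · rw [← h0]; exact norm_nonneg _
    · nlinarith
  refine ⟨hx', ?_⟩
  refine le_of_sq_le_sq ?_ (norm_nonneg _)
  nlinarith [norm_nonneg (x + s)]

variable [CompleteSpace E]

theorem surjective_compositeSum (hreg : IsRegular A T) :
    Function.Surjective (compositeSum A T) := by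
  have hclosed : IsClosed (compositeGraph A T : Set (E × E × E)) := by
    refine IsClosed.inter ?_ ?_
    · have h1 : Continuous fun p : E × E × E => (p.1, p.2.1) := by fun_prop
      exact hreg.isClosed.preimage h1
    · exact isClosed_adjointGraph.preimage (continuous_snd (X := E) (Y := E × E))
  have : CompleteSpace (compositeGraph A T) := hclosed.completeSpace_coe
  have hcont : UniformContinuous (compositeSum A T) := by
    have h1 : UniformContinuous fun p : E × E × E => p.1 + p.2.2 :=
      uniformContinuous_fst.add (uniformContinuous_snd.comp uniformContinuous_snd)
    exact h1.comp uniformContinuous_subtype_val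
  have hanti : AntilipschitzWith 2 (compositeSum A T) := by
    refine AddMonoidHomClass.antilipschitz_of_bound _ ?_
    rintro ⟨⟨x, y, s⟩, h⟩
    obtain ⟨h1, h2⟩ := norm_le_of_compositeGraph h
    change ‖(x, y, s)‖ ≤ ((2 : NNReal) : ℝ) * ‖x + s‖
    have h3 : ‖s‖ ≤ ‖x + s‖ + ‖x‖ := by
      calc ‖s‖ = ‖x + s - x‖ := by rw [add_sub_cancel_left]
        _ ≤ _ := norm_sub_le _ _
    have h4 := norm_nonneg (x + s)
    rw [Prod.norm_def, Prod.norm_def, NNReal.coe_ofNat]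
    exact max_le (by linarith) (max_le (by dsimp only; linarith) (by dsimp only; linarith))
  have hrange := hanti.isClosed_range hcont
  have hdense : DenseRange (compositeSum A T) := by
    refine hreg.dense_range.mono ?_
    rintro w ⟨x, h, rfl⟩
    have hg := (adjoint A T).mem_graph ⟨T x, h⟩
    rw [adjoint_graph_eq hreg.dense_domain] at hg
    exact ⟨⟨(x, T x, adjoint A T ⟨T x, h⟩), T.mem_graph x, hg⟩, rfl⟩
  exact Set.range_eq_univ.mp (hrange.closure_eq ▸ hdense.closure_range)

/-- The resolvent `(1 + T⋆T)⁻¹`. -/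
theorem exists_resolvent (hreg : IsRegular A T) : ∃ R : Adjointable A E, IsSelfAdjoint R ∧
    (∀ t ∈ spectrum ℝ R, 0 ≤ t) ∧
    (∀ n : compositeGraph A T, R.1 (compositeSum A T n) = n.1.1) := by
  have hs := surjective_compositeSum hreg
  obtain ⟨R, hR, hR'⟩ := exists_adjointable_extension (A := A) (e := compositeSum A T)
    (e' := compositeSum A T) (f := LinearMap.fst ℂ E (E × E) ∘ₗ (compositeGraph A T).subtype)
    (g := LinearMap.fst ℂ E (E × E) ∘ₗ (compositeGraph A T).subtype) hs.denseRange hs.denseRange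
    (C := 1) (fun n => by
      rw [one_mul]
      exact (norm_le_of_compositeGraph n.2).1) (by
      rintro ⟨⟨x, y, s⟩, h⟩ ⟨⟨x', y', s'⟩, h'⟩
      obtain ⟨h1, h2⟩ := mem_compositeGraph.mp h
      obtain ⟨h1', h2'⟩ := mem_compositeGraph.mp h'
      change inner A x (x' + s') = inner A (x + s) x'
      rw [CStarModule.inner_add_right, CStarModule.inner_add_left,
        ← inner_of_mem_adjointGraph h1 h2', ← CStarModule.star_inner x' s,
        ← inner_of_mem_adjointGraph h1' h2, CStarModule.star_inner])
  have hsa : IsSelfAdjoint R := Adjointable.ext fun w => by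
    obtain ⟨n, rfl⟩ := hs w
    rw [hR, hR']
  refine ⟨R, hsa, spectrum_nonneg_of_inner_nonneg hsa fun w => ?_, hR⟩
  obtain ⟨⟨⟨x, y, s⟩, h⟩, rfl⟩ := hs w
  rw [inner_apply_right, hsa.star_eq, hR]
  change 0 ≤ inner A x (x + s)
  rw [inner_self_add_of_compositeGraph h]
  exact add_nonneg CStarModule.inner_self_nonneg CStarModule.inner_self_nonneg

theorem denseRange_resolvent (hreg : IsRegular A T) {R : Adjointable A E}
    (hpos : ∀ t ∈ spectrum ℝ R, 0 ≤ t)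
    (hR : ∀ n : compositeGraph A T, R.1 (compositeSum A T n) = n.1.1) : DenseRange R.1 := by
  have hs := surjective_compositeSum hreg
  suffices h : (T.domain : Set E) ⊆ closure (Set.range R.1) by
    refine dense_iff_closure_eq.mpr (Set.eq_univ_of_univ_subset ?_)
    rw [← hreg.dense_domain.closure_eq]
    exact closure_minimal h isClosed_closure
  intro x hx
  set y := T ⟨x, hx⟩ with hy
  have hxy : (x, y) ∈ T.graph := T.mem_graph ⟨x, hx⟩
  have key : ∀ ε : ℝ, 0 < ε → ∃ u ∈ Set.range R.1, ‖x - u‖ ^ 2 ≤ ε * (‖x‖ + ‖y‖) ^ 2 := by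
    intro ε hε
    have hunit : IsUnit (algebraMap ℝ (Adjointable A E) ε + R) := by
      have h1 : -ε ∉ spectrum ℝ R := fun h => by linarith [hpos _ h]
      have h2 := (spectrum.notMem_iff.mp h1).neg
      rwa [map_neg, neg_sub, sub_neg_eq_add, add_comm] at h2
    obtain ⟨V, hV⟩ := hunit.exists_right_inv
    set w := V.1 x
    obtain ⟨⟨⟨u, v, s⟩, h⟩, hw⟩ := hs w
    have hu : R.1 w = u := by rw [← hw, hR]
    have hws : w = u + s := hw.symm
    have hxe : x - u = (ε : ℂ) • (u + s) := by
      have h1 : (algebraMap ℝ (Adjointable A E) ε + R).1 (V.1 x) = x := by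
        rw [← val_mul, hV, val_one]
      have h2 : (algebraMap ℝ (Adjointable A E) ε).1 w = (ε : ℂ) • w := rfl
      rw [val_add] at h1
      change (algebraMap ℝ (Adjointable A E) ε).1 w + R.1 w = x at h1
      rw [h2, hu] at h1
      rw [← hws]
      exact sub_eq_of_eq_add h1.symm
    have hsub : (x - u, y - v) ∈ T.graph := T.graph.sub_mem hxy h.1
    have hid : inner A (x - u) (x - u) + ((ε : ℂ) • inner A u u + (ε : ℂ) • inner A v v) =
        (ε : ℂ) • (inner A x u + inner A y v) := by
      have h1 : inner A (x - u) (x - u) =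
          (ε : ℂ) • (inner A (x - u) u + inner A (y - v) v) := by
        nth_rw 2 [hxe]
        rw [CStarModule.inner_smul_right_complex, CStarModule.inner_add_right,
          inner_of_mem_adjointGraph hsub h.2]
      rw [h1, CStarModule.inner_sub_left, CStarModule.inner_sub_left]
      simp only [smul_add, smul_sub]
      abel
    have hn : ∀ p : E, 0 ≤ (ε : ℂ) • inner A p p := fun p => by
      rw [Complex.coe_smul]
      exact smul_nonneg hε.le CStarModule.inner_self_nonneg
    have hrhs : ‖(ε : ℂ) • (inner A x u + inner A y v)‖ ≤ ε * (‖x‖ * ‖u‖ + ‖y‖ * ‖v‖) := by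
      rw [norm_smul, Complex.norm_real, Real.norm_of_nonneg hε.le]
      gcongr
      exact (norm_add_le _ _).trans (add_le_add (CStarModule.norm_inner_le E)
        (CStarModule.norm_inner_le E))
    have hb1 : ‖x - u‖ ^ 2 ≤ ε * (‖x‖ * ‖u‖ + ‖y‖ * ‖v‖) := by
      rw [CStarModule.norm_sq_eq A]
      refine le_trans (CStarAlgebra.norm_le_norm_of_nonneg_of_le CStarModule.inner_self_nonneg ?_)
        hrhs
      rw [← hid]
      exact le_add_of_nonneg_right (add_nonneg (hn u) (hn v))
    have hb : ∀ p : E, (ε : ℂ) • inner A p p ≤ (ε : ℂ) • (inner A x u + inner A y v) →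
        ‖p‖ ^ 2 ≤ ‖x‖ * ‖u‖ + ‖y‖ * ‖v‖ := by
      intro p hp
      have h1 := (CStarAlgebra.norm_le_norm_of_nonneg_of_le (hn p) hp).trans hrhs
      rw [norm_smul, Complex.norm_real, Real.norm_of_nonneg hε.le, ← CStarModule.norm_sq_eq A] at h1
      exact le_of_mul_le_mul_left h1 hε
    have hb2 : ‖u‖ ^ 2 ≤ ‖x‖ * ‖u‖ + ‖y‖ * ‖v‖ := hb u <| by
      rw [← hid]
      exact le_add_of_nonneg_of_le CStarModule.inner_self_nonneg (le_add_of_nonneg_right (hn v))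
    have hb3 : ‖v‖ ^ 2 ≤ ‖x‖ * ‖u‖ + ‖y‖ * ‖v‖ := hb v <| by
      rw [← hid]
      exact le_add_of_nonneg_of_le CStarModule.inner_self_nonneg (le_add_of_nonneg_left (hn u))
    refine ⟨u, ⟨w, hu⟩, hb1.trans ?_⟩
    have hM : max ‖u‖ ‖v‖ ≤ ‖x‖ + ‖y‖ := by
      set M := max ‖u‖ ‖v‖ with hMdef
      have hu' : ‖u‖ ≤ M := le_max_left _ _
      have hv' : ‖v‖ ≤ M := le_max_right _ _
      have hM2 : M ^ 2 ≤ (‖x‖ + ‖y‖) * M := by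
        have : ‖x‖ * ‖u‖ + ‖y‖ * ‖v‖ ≤ (‖x‖ + ‖y‖) * M := by
          rw [add_mul]
          gcongr
        refine le_trans ?_ this
        rcases max_choice ‖u‖ ‖v‖ with h | h
        · rw [hMdef, h]; exact hb2
        · rw [hMdef, h]; exact hb3
      rcases (show 0 ≤ M from (norm_nonneg u).trans hu').eq_or_lt with h0 | h0
      · rw [← h0]; positivity
      · nlinarith
    have hu' := (le_max_left ‖u‖ ‖v‖).trans hM
    have hv' := (le_max_right ‖u‖ ‖v‖).trans hM
    rw [sq, add_mul]
    gcongr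
  rw [Metric.mem_closure_iff]
  intro δ hδ
  obtain ⟨u, hu, hub⟩ := key (δ ^ 2 / ((‖x‖ + ‖y‖) ^ 2 + 1)) (by positivity)
  refine ⟨u, hu, ?_⟩
  rw [dist_eq_norm]
  refine lt_of_pow_lt_pow_left₀ 2 hδ.le (hub.trans_lt ?_)
  rw [div_mul_eq_mul_div, div_lt_iff₀ (by positivity)]
  nlinarith [sq_pos_of_pos hδ]

/-- The bounded operator `T (1 + T⋆T)^{-1/2}` and its adjoint. -/
theorem exists_boundedTransform (hreg : IsRegular A T) : ∃ R z : Adjointable A E,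
    (∀ n : compositeGraph A T, R.1 (compositeSum A T n) = n.1.1) ∧
    1 - star z * z = R ∧ IsZTransform z ∧
    (∀ n : compositeGraph A T, z.1 ((zRoot z).1 (compositeSum A T n)) = n.1.2.1) ∧
    ∀ v s, (v, s) ∈ adjointGraph A T → (star z).1 v = (zRoot z).1 s := by
  have hs := surjective_compositeSum hreg
  obtain ⟨R, hsa, hpos, hR⟩ := exists_resolvent hreg
  have hdR := denseRange_resolvent hreg hpos hR
  set Q := cfc Real.sqrt R with hQ
  have hQQ : Q * Q = R := cfc_sqrt_mul_self hsa hpos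
  have hQs : star Q = Q := (isSelfAdjoint_cfc_sqrt R).star_eq
  have hdQ : DenseRange Q.1 := denseRange_of_mul (T := Q) (by rwa [hQQ])
  have hQQ' : ∀ w, Q.1 (Q.1 w) = R.1 w := fun w => by rw [← val_mul, hQQ]
  have hdadj : DenseRange (LinearMap.fst ℂ E E ∘ₗ (adjointGraph A T).subtype) := by
    refine hreg.dense_domain_adjoint.mono fun v hv => ?_
    have hg := (adjoint A T).mem_graph ⟨v, hv⟩
    rw [adjoint_graph_eq hreg.dense_domain] at hg
    exact ⟨⟨_, hg⟩, rfl⟩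
  obtain ⟨z, hz, hz'⟩ := exists_adjointable_extension (A := A)
    (e := (Q.1 : E →ₗ[ℂ] E) ∘ₗ compositeSum A T)
    (f := LinearMap.fst ℂ E E ∘ₗ LinearMap.snd ℂ E (E × E) ∘ₗ (compositeGraph A T).subtype)
    (e' := LinearMap.fst ℂ E E ∘ₗ (adjointGraph A T).subtype)
    (g := (Q.1 : E →ₗ[ℂ] E) ∘ₗ LinearMap.snd ℂ E E ∘ₗ (adjointGraph A T).subtype)
    (hdQ.comp hs.denseRange Q.1.continuous) hdadj (C := 1) (by
      rintro ⟨⟨x, y, s⟩, h⟩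
      rw [one_mul]
      change ‖y‖ ≤ ‖Q.1 (x + s)‖
      refine norm_le_of_inner_le (A := A) ?_
      have h1 : R.1 (x + s) = x := hR ⟨_, h⟩
      rw [inner_apply_right, hQs, hQQ', h1, inner_self_add_of_compositeGraph h]
      exact le_add_of_nonneg_left CStarModule.inner_self_nonneg) (by
      rintro ⟨⟨x, y, s⟩, h⟩ ⟨⟨v, r⟩, h'⟩
      obtain ⟨h1, -⟩ := mem_compositeGraph.mp h
      change inner A y v = inner A (Q.1 (x + s)) (Q.1 r)
      have h2 : R.1 (x + s) = x := hR ⟨_, h⟩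
      rw [inner_apply_right, hQs, hQQ', h2]
      exact inner_of_mem_adjointGraph h1 h')
  have hzz : 1 - star z * z = R := by
    refine Adjointable.ext_of_dense (hdQ.comp hs.denseRange Q.1.continuous) ?_
    rintro _ ⟨⟨⟨x, y, s⟩, h⟩, rfl⟩
    change Q.1 (x + s) - (star z).1 (z.1 (Q.1 (x + s))) = R.1 (Q.1 (x + s))
    have h1 : z.1 (Q.1 (x + s)) = y := hz ⟨_, h⟩
    have h2 : (star z).1 y = Q.1 s := hz' ⟨(y, s), (mem_compositeGraph.mp h).2⟩
    have h3 : R.1 (x + s) = x := hR ⟨_, h⟩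
    rw [h1, h2, ← map_sub, add_sub_cancel_right]
    nth_rw 1 [← h3]
    rw [← hQQ', ← hQQ']
  have hroot : zRoot z = Q := by rw [zRoot, hzz]
  refine ⟨R, z, hR, hzz, ⟨by rw [hroot, hQQ, hzz], by rwa [hroot]⟩, ?_, ?_⟩
  · rw [hroot]; exact hz
  · rw [hroot]; exact fun v s h => hz' ⟨(v, s), h⟩

/-- Every normal regular operator has a normal `z`-transform. -/
theorem exists_zTransform (hreg : IsRegular A T) (hnormal : IsNormal A T) :
    ∃ z : Adjointable A E, IsZTransform z ∧ IsStarNormal z ∧ ofZTransform z = T := by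
  have hs := surjective_compositeSum hreg
  obtain ⟨R, z, hR, hzz, hz, hzQ, hz'⟩ := exists_boundedTransform hreg
  have hQR : ∀ w, (zRoot z).1 ((zRoot z).1 w) = R.1 w := fun w => by
    rw [← val_mul, hz.sq, hzz]
  have hsa : IsSelfAdjoint R := by rw [← hzz]; simp [IsSelfAdjoint]
  have hdadj : Dense {v | ∃ s, (v, s) ∈ adjointGraph A T} := by
    refine hreg.dense_domain_adjoint.mono fun v hv => ?_
    have hg := (adjoint A T).mem_graph ⟨v, hv⟩
    rw [adjoint_graph_eq hreg.dense_domain] at hg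
    exact ⟨_, hg⟩
  have hsub : ∀ v, ((zRoot z).1 v, z.1 v) ∈ T.graph := by
    have hc : IsClosed {v | ((zRoot z).1 v, z.1 v) ∈ T.graph} :=
      hreg.isClosed.preimage ((zRoot z).1.continuous.prodMk z.1.continuous)
    have hd : DenseRange fun n => (zRoot z).1 (compositeSum A T n) :=
      hz.dense.comp hs.denseRange (zRoot z).1.continuous
    intro v
    refine hc.closure_subset_iff.mpr ?_ (hd v)
    rintro _ ⟨n, rfl⟩
    change ((zRoot z).1 ((zRoot z).1 (compositeSum A T n)),
      z.1 ((zRoot z).1 (compositeSum A T n))) ∈ T.graph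
    rw [hQR, hR, hzQ]
    exact n.2.1
  -- the double adjoint of `T` is contained in `ofZTransform z`
  have hbi : ∀ a b : E, (∀ v s, (v, s) ∈ adjointGraph A T → inner A s a = inner A v b) →
      (a, b) ∈ (ofZTransform z).graph := by
    intro a b hab
    have h1 : (zRoot z).1 ((zRoot z).1 a + (star z).1 b) = a := by
      refine eq_of_forall_inner (A := A) fun w => ?_
      obtain ⟨⟨⟨x, y, s⟩, h⟩, rfl⟩ := hs w
      rw [map_add, hQR, CStarModule.inner_add_right, inner_apply_right R,
        inner_apply_right (zRoot z), star_zRoot, ← inner_apply_left, hzQ,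
        hsa.star_eq, hR]
      change inner A x a + inner A y b = inner A (x + s) a
      rw [← hab y s (mem_compositeGraph.mp h).2, CStarModule.inner_add_left]
    have h2 : z.1 ((zRoot z).1 a + (star z).1 b) = b := by
      refine eq_of_dense_inner (A := A) hdadj ?_
      rintro v ⟨s, hvs⟩
      have hg := hsub ((zRoot z).1 a + (star z).1 b)
      rw [h1] at hg
      have h3 := congrArg star (inner_of_mem_adjointGraph hg hvs)
      rw [CStarModule.star_inner, CStarModule.star_inner] at h3
      rw [h3, hab v s hvs]
    exact hz.mem_graph_iff.mpr ⟨_, h1, h2⟩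
  have hT : ofZTransform z = T := by
    refine LinearPMap.eq_of_eq_graph (le_antisymm ?_ ?_)
    · rintro ⟨a, b⟩ hab
      obtain ⟨v, hv1, hv2⟩ := hz.mem_graph_iff.mp hab
      simp only at hv1 hv2
      rw [← hv1, ← hv2]
      exact hsub v
    · rintro ⟨a, b⟩ hab
      refine hbi a b fun v s hvs => ?_
      have h3 := congrArg star (inner_of_mem_adjointGraph hab hvs)
      rw [CStarModule.star_inner, CStarModule.star_inner] at h3
      exact h3.symm
  refine ⟨z, hz, ?_, hT⟩
  obtain ⟨hdom, hnorm⟩ := hnormal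
  let Tadj : T.domain →ₗ[ℂ] E := (adjoint A T).toFun ∘ₗ Submodule.inclusion hdom.le
  have hadjmem : ∀ u : T.domain, ((u : E), Tadj u) ∈ adjointGraph A T := fun u => by
    rw [← adjoint_graph_eq hreg.dense_domain]
    exact (adjoint A T).mem_graph (Submodule.inclusion hdom.le u)
  have hadjval : ∀ v s, (v, s) ∈ adjointGraph A T → ∃ u : T.domain, (u : E) = v ∧ Tadj u = s := by
    intro v s hvs
    rw [← adjoint_graph_eq hreg.dense_domain] at hvs
    obtain ⟨u, hu1, hu2⟩ := (LinearPMap.mem_graph_iff _).mp hvs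
    refine ⟨⟨u, hdom.ge u.2⟩, hu1, hu2⟩
  have hpol : ∀ u u' : T.domain, inner A (T u) (T u') = inner A (Tadj u) (Tadj u') :=
    inner_eq_of_inner_self_eq T.toFun Tadj hnorm
  -- `T⋆` commutes with the resolvent
  have hcomm : ∀ w r, (w, r) ∈ adjointGraph A T → (R.1 w, R.1 r) ∈ adjointGraph A T := by
    intro w r hwr
    obtain ⟨⟨⟨x, y, s⟩, h⟩, rfl⟩ := hs w
    obtain ⟨h1, h2⟩ := mem_compositeGraph.mp h
    obtain ⟨u, hu1, hu2⟩ := (LinearPMap.mem_graph_iff T).mp h1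
    simp only at hu1 hu2
    have hts : (Tadj u, s) ∈ T.graph := by
      have hgr : (ofZTransform z).graph = T.graph := by rw [hT]
      rw [← hgr]
      refine hbi _ _ fun v p hvp => ?_
      obtain ⟨u', rfl, rfl⟩ := hadjval v p hvp
      rw [← hpol, hu2]
      exact inner_of_mem_adjointGraph (T.mem_graph u') h2
    have hxt : (x, Tadj u) ∈ adjointGraph A T := hu1 ▸ hadjmem u
    have hsr : (s, r - Tadj u) ∈ adjointGraph A T := by
      have := (adjointGraph A T).sub_mem hwr hxt
      have hx : compositeSum A T ⟨(x, y, s), h⟩ = x + s := rfl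
      rwa [hx, Prod.mk_sub_mk, add_sub_cancel_left] at this
    have hRr : R.1 r = Tadj u := by
      have := hR ⟨(Tadj u, s, r - Tadj u), hts, hsr⟩
      change R.1 (Tadj u + (r - Tadj u)) = Tadj u at this
      rwa [add_sub_cancel] at this
    rw [hR, hRr]
    exact hxt
  have hRz : Commute (1 - star z * z) (star z) := by
    rw [hzz]
    refine Adjointable.ext_of_dense hdadj ?_
    rintro w ⟨r, hwr⟩
    rw [val_mul, val_mul, hz' _ _ hwr, hz' _ _ (hcomm _ _ hwr), ← hQR, ← hQR]
  have hQz : Commute (zRoot z) (star z) := Commute.cfc_real hRz _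
  have hquad : ∀ v, inner A ((star z).1 v) ((star z).1 v) = inner A (z.1 v) (z.1 v) := by
    have hcl : IsClosed {v | inner A ((star z).1 v) ((star z).1 v) = inner A (z.1 v) (z.1 v)} :=
      isClosed_eq
        (CStarModule.continuous_inner.comp ((star z).1.continuous.prodMk (star z).1.continuous))
        (CStarModule.continuous_inner.comp (z.1.continuous.prodMk z.1.continuous))
    intro v
    refine hcl.closure_subset_iff.mpr ?_ ((hz.dense.dense_image (zRoot z).1.continuous hdadj) v)
    rintro _ ⟨w, ⟨r, hwr⟩, rfl⟩
    have hwr' := hcomm _ _ hwr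
    have h1 : (star z).1 ((zRoot z).1 w) = R.1 r := by
      rw [← val_commute hQz, hz' _ _ hwr, hQR]
    obtain ⟨⟨⟨x, y, s⟩, h⟩, rfl⟩ := hs w
    have h2 := hzQ ⟨(x, y, s), h⟩
    obtain ⟨u, hu1, hu2⟩ := (LinearPMap.mem_graph_iff T).mp (mem_compositeGraph.mp h).1
    simp only at hu1 hu2
    have h3 : Tadj u = R.1 r := by
      have hm := hadjmem u
      rw [← adjoint_graph_eq hreg.dense_domain] at hm hwr'
      exact LinearPMap.mem_graph_snd_inj _ hm hwr' (by rw [hu1, hR])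
    change inner A ((star z).1 ((zRoot z).1 _)) ((star z).1 ((zRoot z).1 _)) = _
    rw [h1, h2, ← h3, ← hpol, hu2]
  have hfin := inner_eq_of_inner_self_eq (A := A) ((star z).1 : E →ₗ[ℂ] E) (z.1 : E →ₗ[ℂ] E) hquad
  refine ⟨adjointable_ext fun x y => ?_⟩
  have h1 := hfin x y
  change inner A ((star z).1 x) ((star z).1 y) = inner A (z.1 x) (z.1 y) at h1
  rw [val_mul, val_mul, ← inner_apply_left, ← h1, inner_apply_left, star_star]

end RegularToZ

section Disc

/-- The homeomorphism `t ↦ t (1 + |t|²)^{-1/2}` of the plane onto the open unit disc. -/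
def discMap (t : ℂ) : ℂ := OpenPartialHomeomorph.univUnitBall t

theorem discMap_eq (t : ℂ) : discMap t = t * (((√(1 + ‖t‖ ^ 2))⁻¹ : ℝ) : ℂ) := by
  rw [discMap, OpenPartialHomeomorph.univUnitBall_apply, Complex.real_smul, mul_comm]

theorem isOpenEmbedding_discMap : Topology.IsOpenEmbedding discMap :=
  OpenPartialHomeomorph.isOpenEmbedding OpenPartialHomeomorph.univUnitBall rfl

theorem norm_discMap_lt (t : ℂ) : ‖discMap t‖ < 1 := by
  have := OpenPartialHomeomorph.univUnitBall.map_source (x := t) (Set.mem_univ t)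
  exact mem_ball_zero_iff.mp this

theorem exists_discMap_eq {w : ℂ} (hw : ‖w‖ < 1) : ∃ t, discMap t = w :=
  ⟨OpenPartialHomeomorph.univUnitBall.symm w,
    OpenPartialHomeomorph.univUnitBall.right_inv (mem_ball_zero_iff.mpr hw)⟩

/-- The function `(1 - |w|²)^{1/2}`. -/
def discRoot (w : ℂ) : ℂ := ((√(1 - ‖w‖ ^ 2) : ℝ) : ℂ)

@[fun_prop]
theorem continuous_discRoot : Continuous discRoot := by
  unfold discRoot; fun_prop

theorem discRoot_discMap (t : ℂ) : discRoot (discMap t) = (((√(1 + ‖t‖ ^ 2))⁻¹ : ℝ) : ℂ) := by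
  have h1 : 0 < 1 + ‖t‖ ^ 2 := by positivity
  have h2 : ‖discMap t‖ ^ 2 = ‖t‖ ^ 2 * (1 + ‖t‖ ^ 2)⁻¹ := by
    rw [discMap_eq, norm_mul, Complex.norm_real, Real.norm_of_nonneg (by positivity), mul_pow,
      inv_pow, Real.sq_sqrt h1.le]
  rw [discRoot, h2, ← Real.sqrt_inv]
  congr 2
  field_simp
  ring

theorem discMap_sub_mul_discRoot (c : ℂ) : discMap c - c * discRoot (discMap c) = 0 := by
  rw [discRoot_discMap, discMap_eq, sub_self]

theorem eq_discMap_of_sub_eq_zero {c w : ℂ} (hw : ‖w‖ ≤ 1) (h : w - c * discRoot w = 0) :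
    w = discMap c := by
  have hlt : ‖w‖ < 1 := by
    refine lt_of_le_of_ne hw fun h1 => ?_
    have h2 : discRoot w = 0 := by simp [discRoot, h1]
    rw [h2, mul_zero, sub_zero] at h
    simp [h] at h1
  obtain ⟨t, rfl⟩ := exists_discMap_eq hlt
  have h0 : (((√(1 + ‖t‖ ^ 2))⁻¹ : ℝ) : ℂ) ≠ 0 := by
    have : 0 < √(1 + ‖t‖ ^ 2) := Real.sqrt_pos.mpr (by positivity)
    exact_mod_cast (inv_pos.mpr this).ne'
  rw [discRoot_discMap, discMap_eq, ← sub_mul] at h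
  have := (mul_eq_zero.mp h).resolve_right h0
  rw [sub_eq_zero.mp this]

theorem discRoot_mul_self {w : ℂ} (hw : ‖w‖ ≤ 1) : discRoot w * discRoot w = 1 - star w * w := by
  have h1 : 0 ≤ 1 - ‖w‖ ^ 2 := by nlinarith [norm_nonneg w]
  rw [discRoot, ← Complex.ofReal_mul, Real.mul_self_sqrt h1, Complex.star_def, mul_comm,
    Complex.mul_conj, Complex.normSq_eq_norm_sq]
  push_cast
  ring

end Disc

section Spectrum

variable {A E : Type*} [NonUnitalCStarAlgebra A] [PartialOrder A] [StarOrderedRing A]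
  [NormedAddCommGroup E] [NormedSpace ℂ E] [SMul A E] [CStarModule A E] [CompleteSpace E]
  {z : Adjointable A E}

theorem IsZTransform.norm_le_one (hz : IsZTransform z) : ‖z‖ ≤ 1 := by
  rw [← norm_val]
  refine ContinuousLinearMap.opNorm_le_bound _ zero_le_one fun v => ?_
  rw [one_mul]
  refine norm_le_of_inner_le (A := A) ?_
  have h : inner A v v = inner A ((zRoot z).1 v) ((zRoot z).1 v) + inner A (z.1 v) (z.1 v) := by
    nth_rw 2 [← hz.sq_add_apply v]
    rw [CStarModule.inner_add_right, inner_apply_left z, inner_apply_left (zRoot z), star_zRoot]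
  rw [h]
  exact le_add_of_nonneg_left CStarModule.inner_self_nonneg

theorem IsZTransform.norm_le_of_mem_spectrum (hz : IsZTransform z) {w : ℂ}
    (hw : w ∈ spectrum ℂ z) : ‖w‖ ≤ 1 := by
  have h1 := spectrum.subset_closedBall_norm_mul z hw
  have h2 : ‖(1 : Adjointable A E)‖ ≤ 1 := ContinuousLinearMap.norm_id_le
  rw [mem_closedBall_zero_iff] at h1
  calc ‖w‖ ≤ ‖z‖ * ‖(1 : Adjointable A E)‖ := h1
    _ ≤ 1 * 1 := by gcongr; exact hz.norm_le_one
    _ = 1 := one_mul 1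

theorem IsZTransform.zRoot_eq_cfc (hz : IsZTransform z) (hn : IsStarNormal z) :
    zRoot z = cfc discRoot z := by
  have hreal : ∀ r : ℂ → ℝ, star (cfc (fun w => (r w : ℂ)) z) = cfc (fun w => (r w : ℂ)) z := by
    intro r
    rw [← cfc_star]
    simp [Complex.conj_ofReal]
  refine zRoot_eq (hreal _) ?_ ?_
  · have : cfc discRoot z = star (cfc (fun w : ℂ => ((√(√(1 - ‖w‖ ^ 2)) : ℝ) : ℂ)) z) *
        cfc (fun w : ℂ => ((√(√(1 - ‖w‖ ^ 2)) : ℝ) : ℂ)) z := by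
      rw [hreal, ← cfc_mul (R := ℂ) _ _ z (by fun_prop) (by fun_prop)]
      refine cfc_congr fun w _ => ?_
      simp only [discRoot, ← Complex.ofReal_mul, Real.mul_self_sqrt (Real.sqrt_nonneg _)]
    rw [this]
    exact spectrum_star_mul_self_nonneg
  · rw [← cfc_mul discRoot discRoot z (by fun_prop) (by fun_prop)]
    have h1 : cfc (fun w : ℂ => 1 - star w * w) z = 1 - star z * z := by
      rw [cfc_sub (fun _ => 1) (fun w : ℂ => star w * w) z (by fun_prop) (by fun_prop),
        cfc_const_one ℂ z, cfc_mul (fun w : ℂ => star w) (fun w => w) z (by fun_prop)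
        (by fun_prop), cfc_star_id (ha := hn), cfc_id' ℂ z]
    rw [← h1]
    exact cfc_congr fun w hw => discRoot_mul_self (hz.norm_le_of_mem_spectrum hw)

theorem IsZTransform.sub_smul_eq_cfc (hz : IsZTransform z) (hn : IsStarNormal z) (c : ℂ) :
    z - c • zRoot z = cfc (fun w => w - c * discRoot w) z := by
  rw [cfc_sub (fun w : ℂ => w) (fun w => c * discRoot w) z (by fun_prop) (by fun_prop),
    cfc_id' ℂ z, cfc_const_mul c discRoot z (by fun_prop), hz.zRoot_eq_cfc hn]

theorem IsZTransform.isUnit_sub_smul_iff (hz : IsZTransform z) (hn : IsStarNormal z) (c : ℂ) :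
    IsUnit (z - c • zRoot z) ↔ discMap c ∉ spectrum ℂ z := by
  rw [hz.sub_smul_eq_cfc hn, isUnit_cfc_iff (fun w => w - c * discRoot w) z (by fun_prop) hn]
  constructor
  · exact fun h hc => h _ hc (discMap_sub_mul_discRoot c)
  · intro h w hw h0
    rw [eq_discMap_of_sub_eq_zero (hz.norm_le_of_mem_spectrum hw) h0] at hw
    exact h hw

theorem IsZTransform.subScalar_apply (hz : IsZTransform z) (c : ℂ) (v : E)
    (x : (subScalar (ofZTransform z) c).domain) (hx : (zRoot z).1 v = x) :
    subScalar (ofZTransform z) c x = (z - c • zRoot z).1 v := by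
  have h1 : subScalar (ofZTransform z) c x = ofZTransform z x - c • (x : E) := rfl
  rw [h1, hz.apply v x hx, val_sub, val_smul, hx]

theorem IsZTransform.isAdjointableInvertible_iff (hz : IsZTransform z) (c : ℂ) :
    IsAdjointableInvertible A (subScalar (ofZTransform z) c) ↔ IsUnit (z - c • zRoot z) := by
  constructor
  · rintro ⟨S, hS1, hS2⟩
    have hSB : S * (z - c • zRoot z) = zRoot z := Adjointable.ext fun v => by
      have := hS1 ⟨(zRoot z).1 v, hz.mem_domain_iff.mpr ⟨v, rfl⟩⟩
      rwa [hz.subScalar_apply c v _ rfl] at this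
    have hVB : (zRoot z * S + star z * (1 + c • S)) * (z - c • zRoot z) = 1 := by
      have h1 : (zRoot z * S + star z * (1 + c • S)) * (z - c • zRoot z) =
          zRoot z * (S * (z - c • zRoot z)) +
            star z * (z - c • zRoot z + c • (S * (z - c • zRoot z))) := by
        rw [add_mul, mul_assoc, mul_assoc, add_mul, one_mul, smul_mul_assoc]
      rw [h1, hSB, sub_add_cancel, hz.sq_add]
    refine isUnit_iff_exists.mpr ⟨_, Adjointable.ext fun y => ?_, hVB⟩
    obtain ⟨h, hy⟩ := hS2 y
    obtain ⟨v, hv⟩ := hz.mem_domain_iff.mp h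
    rw [hz.subScalar_apply c v _ hv] at hy
    rw [val_one, ← hy, ← val_mul, mul_assoc, hVB, mul_one]
  · intro h
    obtain ⟨V, hV1, hV2⟩ := isUnit_iff_exists.mp h
    refine ⟨zRoot z * V, ?_, ?_⟩
    · rintro ⟨x, hx⟩
      obtain ⟨v, rfl⟩ := hz.mem_domain_iff.mp hx
      rw [hz.subScalar_apply c v _ rfl, ← val_mul, mul_assoc, hV2, mul_one]
    · intro y
      refine ⟨hz.mem_domain_iff.mpr ⟨V.1 y, rfl⟩, ?_⟩
      rw [hz.subScalar_apply c (V.1 y) _ rfl, ← val_mul, hV1, val_one]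

theorem IsZTransform.mem_opSpectrum_iff (hz : IsZTransform z) (hn : IsStarNormal z) {c : ℂ} :
    c ∈ opSpectrum A (ofZTransform z) ↔ discMap c ∈ spectrum ℂ z := by
  change ¬ IsAdjointableInvertible A (subScalar (ofZTransform z) c) ↔ _
  rw [hz.isAdjointableInvertible_iff, hz.isUnit_sub_smul_iff hn, not_not]

theorem IsZTransform.isClosed_opSpectrum (hz : IsZTransform z) (hn : IsStarNormal z) :
    IsClosed (opSpectrum A (ofZTransform z)) := by
  have : opSpectrum A (ofZTransform z) = discMap ⁻¹' spectrum ℂ z := by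
    ext c; exact hz.mem_opSpectrum_iff hn
  rw [this]
  exact (spectrum.isClosed z).preimage isOpenEmbedding_discMap.continuous

theorem IsZTransform.denseRange_of_isInvertible (hz : IsZTransform z) {c : ℂ}
    (h : IsInvertible A (subScalar (ofZTransform z) c)) : DenseRange (z - c • zRoot z).1 := by
  have hd := h.2.dense_domain
  rw [LinearPMap.inverse_domain] at hd
  refine hd.mono ?_
  rintro _ ⟨x, rfl⟩
  obtain ⟨v, hv⟩ := hz.mem_domain_iff.mp x.2
  exact ⟨v, (hz.subScalar_apply c v x hv).symm⟩

end Spectrum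

section ExtendByZero

variable {X : Type*} [TopologicalSpace X] {j : X → ℂ}

theorem continuousOn_extend_zero (hj : Topology.IsEmbedding j) (g : C₀(X, ℂ)) {Ω U : Set ℂ}
    (hU : IsOpen U) (hUj : Set.range j ⊆ U) (hΩ : Ω ∩ U ⊆ Set.range j) :
    ContinuousOn (Function.extend j g 0) Ω := by
  intro w hw
  by_cases hwj : w ∈ Set.range j
  · have h1 : ContinuousWithinAt (Function.extend j g 0) (Set.range j) w := by
      obtain ⟨x, rfl⟩ := hwj
      rw [ContinuousWithinAt, ← hj.isInducing.map_nhds_eq, Filter.tendsto_map'_iff,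
        Function.extend_comp hj.injective, hj.injective.extend_apply]
      exact g.continuous.tendsto x
    have h2 : ContinuousWithinAt (Function.extend j g 0) (Ω ∩ U) w := h1.mono hΩ
    exact (continuousWithinAt_inter (hU.mem_nhds (hUj hwj))).mp h2
  · have h0 : Function.extend j g 0 w = 0 := Function.extend_apply' _ _ _ hwj
    refine ContinuousAt.continuousWithinAt ?_
    rw [ContinuousAt, h0, Metric.tendsto_nhds]
    intro ε hε
    have h1 := (tendsto_order.1 (tendsto_zero_iff_norm_tendsto_zero.mp g.zero_at_infty')).2 ε hε
    obtain ⟨K, hK, hKs⟩ := Filter.mem_cocompact.mp h1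
    have hKc : IsClosed (j '' K) := (hK.image hj.continuous).isClosed
    have hwK : w ∉ j '' K := fun ⟨x, _, hx⟩ => hwj ⟨x, hx⟩
    filter_upwards [hKc.isOpen_compl.mem_nhds hwK] with w' hw'
    rw [dist_zero_right]
    by_cases hj' : w' ∈ Set.range j
    · obtain ⟨x, rfl⟩ := hj'
      rw [hj.injective.extend_apply]
      exact hKs fun hx => hw' ⟨x, hx, rfl⟩
    · rw [Function.extend_apply' _ _ _ hj', Pi.zero_apply, norm_zero]
      exact hε

/-- A continuous function on a compact set that vanishes off the image of `j` restricts to a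
function vanishing at infinity. -/
theorem exists_zeroAtInfty_comp (hj : Topology.IsEmbedding j) {Ω : Set ℂ} (hΩ : IsCompact Ω)
    (hjΩ : Set.range j ⊆ Ω) {p : ℂ → ℂ} (hp : Continuous p)
    (h0 : ∀ w ∈ Ω, w ∉ Set.range j → p w = 0) :
    ∃ g : C₀(X, ℂ), Set.EqOn (Function.extend j g 0) p Ω := by
  refine ⟨⟨⟨fun x => p (j x), hp.comp hj.continuous⟩, ?_⟩, ?_⟩
  · rw [Metric.tendsto_nhds]
    intro ε hε
    have hC : IsCompact (Ω ∩ {w | ε ≤ ‖p w‖}) :=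
      hΩ.inter_right (isClosed_le continuous_const hp.norm)
    have hsub : Ω ∩ {w | ε ≤ ‖p w‖} ⊆ Set.range j := by
      rintro w ⟨hw, hw'⟩
      by_contra hwj
      have hle : ε ≤ ‖p w‖ := hw'
      rw [h0 w hw hwj, norm_zero] at hle
      linarith
    have hK := (hj.isInducing.isCompact_preimage_iff hsub).mpr hC
    filter_upwards [hK.compl_mem_cocompact] with x hx
    rw [dist_zero_right]
    by_contra! hle
    exact hx ⟨hjΩ ⟨x, rfl⟩, hle⟩
  · intro w hw
    by_cases hwj : w ∈ Set.range j
    · obtain ⟨x, rfl⟩ := hwj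
      rw [hj.injective.extend_apply]
      rfl
    · rw [Function.extend_apply' _ _ _ hwj, Pi.zero_apply, h0 w hw hwj]

end ExtendByZero

section DiscExtend

/-- The embedding of `G` into the unit disc. -/
def discEmb (G : Set ℂ) (t : G) : ℂ := discMap t

theorem isEmbedding_discEmb (G : Set ℂ) : Topology.IsEmbedding (discEmb G) :=
  isOpenEmbedding_discMap.isEmbedding.comp Topology.IsEmbedding.subtypeVal

/-- A function on `G`, transported to the unit disc and extended by zero. -/
def discExtend {G : Set ℂ} (g : G → ℂ) : ℂ → ℂ := Function.extend (discEmb G) g 0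

theorem discExtend_apply {G : Set ℂ} (g : G → ℂ) (t : G) : discExtend g (discEmb G t) = g t :=
  (isEmbedding_discEmb G).injective.extend_apply _ _ _

theorem discExtend_of_notMem {G : Set ℂ} (g : G → ℂ) {w : ℂ} (hw : w ∉ Set.range (discEmb G)) :
    discExtend g w = 0 :=
  Function.extend_apply' _ _ _ hw

theorem discExtend_eq_of_forall {G : Set ℂ} {g : G → ℂ} {p : ℂ → ℂ}
    (h : ∀ t, g t = p (discEmb G t)) (h0 : ∀ w ∉ Set.range (discEmb G), p w = 0) :
    discExtend g = p := by
  ext w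
  by_cases hw : w ∈ Set.range (discEmb G)
  · obtain ⟨t, rfl⟩ := hw
    rw [discExtend_apply, h]
  · rw [discExtend_of_notMem _ hw, h0 w hw]

/-- The compact subset of the closed disc that is obtained from the closed set `H ⊆ ℂ` by adding
the unit circle. -/
def discCompact (H : Set ℂ) : Set ℂ := Metric.closedBall 0 1 \ discMap '' Hᶜ

theorem isCompact_discCompact {H : Set ℂ} (hH : IsClosed H) : IsCompact (discCompact H) :=
  (isCompact_closedBall 0 1).diff (isOpenEmbedding_discMap.isOpenMap _ hH.isOpen_compl)

theorem discMap_mem_discCompact {H : Set ℂ} {t : ℂ} : discMap t ∈ discCompact H ↔ t ∈ H := by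
  rw [discCompact, Set.mem_sdiff, isOpenEmbedding_discMap.injective.mem_set_image,
    Set.notMem_compl_iff, mem_closedBall_zero_iff, and_iff_right (norm_discMap_lt t).le]

theorem range_discEmb_subset {G H : Set ℂ} (h : G ⊆ H) :
    Set.range (discEmb G) ⊆ discCompact H := by
  rintro _ ⟨t, rfl⟩
  exact discMap_mem_discCompact.mpr (h t.2)

theorem continuousOn_discExtend {G : Set ℂ} (N : Finset ℂ) (g : C₀(G, ℂ)) :
    ContinuousOn (discExtend g) (discCompact (G ∪ N)) := by
  refine continuousOn_extend_zero (isEmbedding_discEmb G) g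
    (U := Metric.ball 0 1 \ discMap '' ((N : Set ℂ) \ G)) ?_ ?_ ?_
  · exact Metric.isOpen_ball.sdiff ((N.finite_toSet.sdiff).image _).isClosed
  · rintro _ ⟨t, rfl⟩
    refine ⟨mem_ball_zero_iff.mpr (norm_discMap_lt t), ?_⟩
    rintro ⟨s, hs, hst⟩
    rw [isOpenEmbedding_discMap.injective hst] at hs
    exact hs.2 t.2
  · rintro w ⟨hw, hwb, hwN⟩
    obtain ⟨t, rfl⟩ := exists_discMap_eq (mem_ball_zero_iff.mp hwb)
    have ht : t ∈ G := by
      rcases discMap_mem_discCompact.mp hw with h | h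
      · exact h
      · by_contra htG
        exact hwN ⟨t, ⟨h, htG⟩, rfl⟩
    exact ⟨⟨t, ht⟩, rfl⟩

end DiscExtend

section CalculusOnSet

variable {A E : Type*} [NonUnitalCStarAlgebra A] [PartialOrder A] [StarOrderedRing A]
  [NormedAddCommGroup E] [NormedSpace ℂ E] [SMul A E] [CStarModule A E] [CompleteSpace E]

/-- The hypotheses on `G` under which the functional calculus of `ofZTransform z` exists on `G`. -/
structure IsCalculusSet (z : Adjointable A E) (G : Set ℂ) (N : Finset ℂ) : Prop where
  isClosed : IsClosed (G ∪ N)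
  opSpectrum_subset : opSpectrum A (ofZTransform z) ⊆ G ∪ N
  dense : ∀ c ∈ N, c ∉ G → DenseRange (z - c • zRoot z).1

variable {z : Adjointable A E} {G : Set ℂ} {N : Finset ℂ}

theorem exists_isCalculusSet (hz : IsZTransform z) (hn : IsStarNormal z)
    (hG : IsCompatibleSet A (ofZTransform z) G) : ∃ N, IsCalculusSet z G N := by
  classical
  obtain ⟨⟨L, hL⟩, K, hK, hKG⟩ := hG
  refine ⟨L ∪ K, ?_, ?_, ?_⟩
  · rw [Finset.coe_union, ← Set.union_assoc]
    exact hL.union K.finite_toSet.isClosed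
  · intro c hc
    by_cases hcK : c ∈ K
    · exact Or.inr (by simp [hcK])
    · exact Or.inl (hKG ⟨hc, hcK⟩)
  · intro c _ hcG
    by_cases hc : c ∈ opSpectrum A (ofZTransform z)
    · have hcK : c ∈ K := by
        by_contra hcK
        exact hcG (hKG ⟨hc, hcK⟩)
      exact hz.denseRange_of_isInvertible (hK c hcK)
    · rw [hz.mem_opSpectrum_iff hn, ← hz.isUnit_sub_smul_iff hn] at hc
      exact denseRange_of_isUnit hc

namespace IsCalculusSet

variable (hG : IsCalculusSet z G N)
include hG

theorem spectrum_subset (hz : IsZTransform z) (hn : IsStarNormal z) :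
    spectrum ℂ z ⊆ discCompact (G ∪ N) := by
  intro w hw
  refine ⟨mem_closedBall_zero_iff.mpr (hz.norm_le_of_mem_spectrum hw), ?_⟩
  rintro ⟨t, ht, rfl⟩
  exact ht (hG.opSpectrum_subset ((hz.mem_opSpectrum_iff hn).mpr hw))

theorem continuousOn_spectrum (hz : IsZTransform z) (hn : IsStarNormal z) (g : C₀(G, ℂ)) :
    ContinuousOn (discExtend g) (spectrum ℂ z) :=
  (continuousOn_discExtend N g).mono (hG.spectrum_subset hz hn)

/-- The functional calculus on `G`. -/
def hom (hz : IsZTransform z) (hn : IsStarNormal z) : C₀(G, ℂ) →⋆ₙₐ[ℂ] Adjointable A E where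
  toFun g := cfc (discExtend g) z
  map_smul' c g := by
    have h := hG.continuousOn_spectrum hz hn g
    rw [MonoidHom.id_apply, ← cfc_const_mul c _ z h]
    congr 1
    exact discExtend_eq_of_forall (fun t => by rw [discExtend_apply]; rfl)
      fun w hw => by rw [discExtend_of_notMem _ hw, mul_zero]
  map_zero' := by
    have : discExtend (⇑(0 : C₀(G, ℂ))) = fun _ => 0 :=
      discExtend_eq_of_forall (fun _ => rfl) fun _ _ => rfl
    rw [this, cfc_const_zero]
  map_add' g h := by
    rw [← cfc_add z _ _ (hG.continuousOn_spectrum hz hn g) (hG.continuousOn_spectrum hz hn h)]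
    congr 1
    exact discExtend_eq_of_forall (fun t => by rw [discExtend_apply, discExtend_apply]; rfl)
      fun w hw => by rw [discExtend_of_notMem _ hw, discExtend_of_notMem _ hw, add_zero]
  map_mul' g h := by
    rw [← cfc_mul _ _ z (hG.continuousOn_spectrum hz hn g) (hG.continuousOn_spectrum hz hn h)]
    congr 1
    exact discExtend_eq_of_forall (fun t => by rw [discExtend_apply, discExtend_apply]; rfl)
      fun w hw => by rw [discExtend_of_notMem _ hw, discExtend_of_notMem _ hw, mul_zero]
  map_star' g := by
    rw [← cfc_star]
    congr 1
    exact discExtend_eq_of_forall (fun t => by rw [discExtend_apply]; rfl)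
      fun w hw => by rw [discExtend_of_notMem _ hw, star_zero]

theorem hom_apply (hz : IsZTransform z) (hn : IsStarNormal z) (g : C₀(G, ℂ)) :
    hG.hom hz hn g = cfc (discExtend g) z := rfl

theorem isNondegenerate_hom (hz : IsZTransform z) (hn : IsStarNormal z) :
    IsNondegenerate (hG.hom hz hn) := by
  classical
  have hdense : ∀ s : Finset ℂ, s ⊆ N.filter (· ∉ G) →
      DenseRange (cfc (fun w => discRoot w * ∏ c ∈ s, (w - c * discRoot w)) z).1 := by
    intro s
    induction s using Finset.induction_on with
    | empty =>
      intro _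
      simp only [Finset.prod_empty, mul_one]
      have := hz.dense
      rwa [hz.zRoot_eq_cfc hn] at this
    | insert a s ha ih =>
      intro hs
      have haN := Finset.mem_filter.mp (hs (Finset.mem_insert_self a s))
      have h1 : cfc (fun w => discRoot w * ∏ c ∈ insert a s, (w - c * discRoot w)) z =
          cfc (fun w => w - a * discRoot w) z *
            cfc (fun w => discRoot w * ∏ c ∈ s, (w - c * discRoot w)) z := by
        rw [← cfc_mul (fun w => w - a * discRoot w) _ z (by fun_prop) (by fun_prop)]
        congr 1
        ext w
        rw [Finset.prod_insert ha]
        ring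
      rw [h1, ← hz.sub_smul_eq_cfc hn]
      exact denseRange_mul (hG.dense a haN.1 haN.2)
        (ih ((Finset.subset_insert a s).trans hs))
  obtain ⟨g, hg⟩ := exists_zeroAtInfty_comp (isEmbedding_discEmb G)
    (isCompact_discCompact hG.isClosed) (range_discEmb_subset Set.subset_union_left)
    (p := fun w => discRoot w * ∏ c ∈ N.filter (· ∉ G), (w - c * discRoot w)) (by fun_prop)
    (by
      intro w hw hwj
      rcases (mem_closedBall_zero_iff.mp hw.1).eq_or_lt with h1 | h1
      · have : discRoot w = 0 := by simp [discRoot, h1]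
        rw [this, zero_mul]
      · obtain ⟨t, rfl⟩ := exists_discMap_eq h1
        have htG : t ∉ G := fun h => hwj ⟨⟨t, h⟩, rfl⟩
        have htN : t ∈ N := (discMap_mem_discCompact.mp hw).resolve_left htG
        rw [Finset.prod_eq_zero (Finset.mem_filter.mpr ⟨htN, htG⟩) (discMap_sub_mul_discRoot t),
          mul_zero])
  have hgz : hG.hom hz hn g =
      cfc (fun w => discRoot w * ∏ c ∈ N.filter (· ∉ G), (w - c * discRoot w)) z :=
    cfc_congr fun w hw => hg (hG.spectrum_subset hz hn hw)
  have hd := hdense _ subset_rfl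
  rw [← hgz] at hd
  refine hd.mono ?_
  rintro _ ⟨v, rfl⟩
  exact Submodule.subset_span ⟨g, v, rfl⟩

theorem multiplierExt_zFun_hom (hz : IsZTransform z) (hn : IsStarNormal z) :
    multiplierExt (hG.hom hz hn) (zFun (idFun G)) = z := by
  refine multiplierExt_eq (hG.isNondegenerate_hom hz hn) fun g v => ?_
  rw [← val_mul]
  congr 2
  rw [hom_apply, hom_apply]
  nth_rw 1 [← cfc_id' ℂ z]
  rw [← cfc_mul (fun w => w) _ z (by fun_prop) (hG.continuousOn_spectrum hz hn g)]
  congr 1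
  refine (discExtend_eq_of_forall (fun t => ?_) fun w hw => ?_).symm
  · rw [discExtend_apply, bcfMul_apply, zFun_apply]
    congr 1
    exact (discMap_eq t).symm
  · rw [discExtend_of_notMem _ hw, mul_zero]

theorem isCalculus_hom (hz : IsZTransform z) (hn : IsStarNormal z) :
    IsCalculus (ofZTransform z) (hG.hom hz hn) :=
  ⟨hG.isNondegenerate_hom hz hn, by rw [affiliatedImage, hG.multiplierExt_zFun_hom hz hn]⟩

/-- The functional calculus on `G` is unique. -/
theorem eq_hom_of_isCalculus (hz : IsZTransform z) (hn : IsStarNormal z)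
    {π : C₀(G, ℂ) →⋆ₙₐ[ℂ] Adjointable A E} (hπ : IsCalculus (ofZTransform z) π) :
    π = hG.hom hz hn := by
  obtain ⟨hnd, himg⟩ := hπ
  have hπz : multiplierExt π (zFun (idFun G)) = z :=
    ofZTransform_injective (isZTransform_multiplierExt hnd _) hz himg
  have hcompact : CompactSpace (discCompact (G ∪ N)) :=
    isCompact_iff_compactSpace.mp (isCompact_discCompact hG.isClosed)
  let j : C(G, discCompact (G ∪ N)) :=
    ⟨fun t => ⟨discEmb G t, range_discEmb_subset Set.subset_union_left ⟨t, rfl⟩⟩,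
      (isEmbedding_discEmb G).continuous.subtype_mk _⟩
  let pull : C(discCompact (G ∪ N), ℂ) →⋆ₐ[ℂ] BoundedContinuousFunction G ℂ :=
    { toFun := fun h => (BoundedContinuousFunction.mkOfCompact h).compContinuous j
      map_one' := rfl
      map_mul' := fun _ _ => rfl
      map_zero' := rfl
      map_add' := fun _ _ => rfl
      commutes' := fun _ => rfl
      map_star' := fun _ => rfl }
  let φ : C(discCompact (G ∪ N), ℂ) →⋆ₐ[ℂ] Adjointable A E := (multiplierHom hnd).comp pull
  let ψ : C(discCompact (G ∪ N), ℂ) →⋆ₐ[ℂ] Adjointable A E :=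
    (cfcHom (R := ℂ) hn).comp (ContinuousMap.compStarAlgHom' ℂ ℂ
      ⟨Set.inclusion (hG.spectrum_subset hz hn), continuous_inclusion _⟩)
  have hcont : ∀ χ : C(discCompact (G ∪ N), ℂ) →⋆ₐ[ℂ] Adjointable A E, Continuous χ := fun χ =>
    AddMonoidHomClass.continuous_of_bound χ 1 fun a => by
      rw [one_mul]; exact NonUnitalStarAlgHom.norm_apply_le χ a
  have hφψ : φ = ψ := by
    refine ContinuousMap.starAlgHom_ext_map_X (hcont φ) (hcont ψ) ?_
    have h1 : φ (Polynomial.toContinuousMapOnAlgHom _ Polynomial.X) = z := by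
      rw [← hπz, ← multiplierHom_coe hnd]
      change multiplierHom hnd (pull _) = _
      congr 1
      ext t
      rw [zFun_apply]
      change Polynomial.eval (discMap t) Polynomial.X = _
      rw [Polynomial.eval_X]
      exact discMap_eq t
    have h2 : ψ (Polynomial.toContinuousMapOnAlgHom _ Polynomial.X) = z := by
      refine Eq.trans ?_ (cfcHom_id (R := ℂ) hn)
      change cfcHom (R := ℂ) hn _ = _
      congr 1
      ext w
      exact Polynomial.eval_X
    rw [h1, h2]
  ext1 g
  let h : C(discCompact (G ∪ N), ℂ) :=
    ⟨(discCompact (G ∪ N)).domRestrict (discExtend g), (continuousOn_discExtend N g).domRestrict⟩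
  have h1 : φ h = π g := by
    rw [← multiplierHom_toBCF hnd]
    change multiplierHom hnd (pull h) = _
    congr 1
    ext t
    exact discExtend_apply g t
  have h2 : ψ h = hG.hom hz hn g := by
    rw [hom_apply, cfc_apply _ z hn (hG.continuousOn_spectrum hz hn g)]
    rfl
  rw [← h1, hφψ, h2]

theorem injective_hom_of_subset (hz : IsZTransform z) (hn : IsStarNormal z)
    (hsub : G ⊆ opSpectrum A (ofZTransform z)) : Function.Injective (hG.hom hz hn) := by
  rw [injective_iff_map_eq_zero]
  intro g hg
  have h1 : spectrum ℂ (hG.hom hz hn g) = discExtend g '' spectrum ℂ z :=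
    cfc_map_spectrum _ z hn (hG.continuousOn_spectrum hz hn g)
  ext t
  have h2 : g t ∈ spectrum ℂ (hG.hom hz hn g) := by
    rw [h1]
    exact ⟨discEmb G t, (hz.mem_opSpectrum_iff hn).mp (hsub t.2), discExtend_apply g t⟩
  rw [hg] at h2
  by_contra hne
  refine h2 ?_
  rw [spectrum.mem_resolventSet_iff, sub_zero]
  exact (isUnit_iff_ne_zero.mpr hne).map _

/-- The functional calculi on two nested sets agree. -/
theorem multiplierExt_hom_restrict {G' : Set ℂ} {N' : Finset ℂ} (hG' : IsCalculusSet z G' N')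
    (hz : IsZTransform z) (hn : IsStarNormal z) (hsub : G' ⊆ G)
    (m : BoundedContinuousFunction G ℂ) :
    multiplierExt (hG.hom hz hn) m = multiplierExt (hG'.hom hz hn)
      (m.compContinuous ⟨Set.inclusion hsub, continuous_inclusion hsub⟩) := by
  set ι : C(G', G) := ⟨Set.inclusion hsub, continuous_inclusion hsub⟩ with hι
  have hnd' := hG'.isNondegenerate_hom hz hn
  have key : ∀ (g : C₀(G, ℂ)) (h : C₀(G', ℂ)), hG.hom hz hn g * hG'.hom hz hn h =
      hG'.hom hz hn (bcfMul (g.toBCF.compContinuous ι) h) := by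
    intro g h
    rw [hom_apply, hom_apply, hom_apply, ← cfc_mul _ _ z (hG.continuousOn_spectrum hz hn g)
      (hG'.continuousOn_spectrum hz hn h)]
    congr 1
    refine (discExtend_eq_of_forall (fun t => ?_) fun w hw => ?_).symm
    · rw [discExtend_apply, bcfMul_apply]
      congr 1
      exact (discExtend_apply g (Set.inclusion hsub t)).symm
    · rw [discExtend_of_notMem _ hw, mul_zero]
  refine multiplierExt_eq (hG.isNondegenerate_hom hz hn) fun g v => ?_
  rw [← val_mul]
  congr 2
  refine ext_of_isNondegenerate hnd' fun h v => ?_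
  rw [val_mul, ← val_mul (hG.hom hz hn g), ← val_mul (hG.hom hz hn (bcfMul m g)), key, key,
    multiplierExt_apply hnd']
  congr 3
  ext t
  simp only [bcfMul_apply, BoundedContinuousFunction.compContinuous_apply]
  exact (mul_assoc _ _ _).symm

theorem affiliatedImage_hom_restrict {G' : Set ℂ} {N' : Finset ℂ} (hG' : IsCalculusSet z G' N')
    (hz : IsZTransform z) (hn : IsStarNormal z) (hsub : G' ⊆ G) (f : C(G, ℂ)) :
    affiliatedImage (hG.hom hz hn) f = affiliatedImage (hG'.hom hz hn) (restrictTo hsub f) := by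
  rw [affiliatedImage, affiliatedImage, hG.multiplierExt_hom_restrict hG' hz hn hsub]
  rfl

end IsCalculusSet

end CalculusOnSet

section Main

variable {A E : Type*} [NonUnitalCStarAlgebra A] [PartialOrder A] [StarOrderedRing A]
  [NormedAddCommGroup E] [NormedSpace ℂ E] [SMul A E] [CStarModule A E] [CompleteSpace E]
  {z : Adjointable A E} (hz : IsZTransform z) (hn : IsStarNormal z)

include hz hn

theorem isCompatibleSet_opSpectrum :
    IsCompatibleSet A (ofZTransform z) (opSpectrum A (ofZTransform z)) :=
  ⟨⟨∅, by simpa using hz.isClosed_opSpectrum hn⟩, ∅, by simp, Set.sdiff_subset⟩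

theorem isCompatibleSet_opSpectrum_sdiff {K : Finset ℂ}
    (hK : ∀ c ∈ K, IsInvertible A (subScalar (ofZTransform z) c)) :
    IsCompatibleSet A (ofZTransform z) (opSpectrum A (ofZTransform z) \ K) := by
  refine ⟨⟨K, ?_⟩, K, hK, subset_rfl⟩
  rw [Set.sdiff_union_self]
  exact (hz.isClosed_opSpectrum hn).union K.finite_toSet.isClosed

theorem affiliatedImage_restrictTo_eq {D : Set ℂ} (f : C(D, ℂ)) {K K' : Finset ℂ}
    (hK : IsAdmissible A (ofZTransform z) D K) (hK' : IsAdmissible A (ofZTransform z) D K')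
    {π : C₀((opSpectrum A (ofZTransform z) \ K : Set ℂ), ℂ) →⋆ₙₐ[ℂ] Adjointable A E}
    {π' : C₀((opSpectrum A (ofZTransform z) \ K' : Set ℂ), ℂ) →⋆ₙₐ[ℂ] Adjointable A E}
    (hπ : IsCalculus (ofZTransform z) π) (hπ' : IsCalculus (ofZTransform z) π') :
    affiliatedImage π (restrictTo hK.2 f) = affiliatedImage π' (restrictTo hK'.2 f) := by
  classical
  obtain ⟨N, hN⟩ := exists_isCalculusSet hz hn (isCompatibleSet_opSpectrum_sdiff hz hn hK.1)
  obtain ⟨N', hN'⟩ := exists_isCalculusSet hz hn (isCompatibleSet_opSpectrum_sdiff hz hn hK'.1)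
  obtain ⟨M, hM⟩ := exists_isCalculusSet hz hn (isCompatibleSet_opSpectrum_sdiff hz hn
    (K := K ∪ K') fun c hc => (Finset.mem_union.mp hc).elim (hK.1 c) (hK'.1 c))
  rw [hN.eq_hom_of_isCalculus hz hn hπ, hN'.eq_hom_of_isCalculus hz hn hπ',
    hN.affiliatedImage_hom_restrict hM hz hn
      (Set.sdiff_subset_sdiff_right (by simp)),
    hN'.affiliatedImage_hom_restrict hM hz hn
      (Set.sdiff_subset_sdiff_right (by simp))]
  rfl

theorem extFun_eq {D : Set ℂ} (f : C(D, ℂ)) {K : Finset ℂ}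
    (hK : IsAdmissible A (ofZTransform z) D K)
    {π : C₀((opSpectrum A (ofZTransform z) \ K : Set ℂ), ℂ) →⋆ₙₐ[ℂ] Adjointable A E}
    (hπ : IsCalculus (ofZTransform z) π) :
    extFun A (ofZTransform z) f = affiliatedImage π (restrictTo hK.2 f) := by
  have h : ∃ (K : Finset ℂ) (_ : IsAdmissible A (ofZTransform z) D K)
      (π : C₀((opSpectrum A (ofZTransform z) \ K : Set ℂ), ℂ) →⋆ₙₐ[ℂ] Adjointable A E),
      IsCalculus (ofZTransform z) π := ⟨K, hK, π, hπ⟩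
  rw [extFun, dif_pos h]
  exact affiliatedImage_restrictTo_eq hz hn f h.choose_spec.choose hK
    h.choose_spec.choose_spec.choose_spec hπ

theorem exists_isCalculus_sdiff {K : Finset ℂ}
    (hK : ∀ c ∈ K, IsInvertible A (subScalar (ofZTransform z) c)) :
    ∃ π : C₀((opSpectrum A (ofZTransform z) \ K : Set ℂ), ℂ) →⋆ₙₐ[ℂ] Adjointable A E,
      IsCalculus (ofZTransform z) π := by
  obtain ⟨N, hN⟩ := exists_isCalculusSet hz hn (isCompatibleSet_opSpectrum_sdiff hz hn hK)
  exact ⟨_, hN.isCalculus_hom hz hn⟩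

theorem isCalculus_stdCalculus :
    IsCalculus (ofZTransform z) (stdCalculus A (ofZTransform z)) ∧
      Function.Injective (stdCalculus A (ofZTransform z)) := by
  obtain ⟨N, hN⟩ := exists_isCalculusSet hz hn (isCompatibleSet_opSpectrum hz hn)
  have h : ∃ ψ : C₀(opSpectrum A (ofZTransform z), ℂ) →⋆ₙₐ[ℂ] Adjointable A E,
      IsCalculus (ofZTransform z) ψ ∧ Function.Injective ψ :=
    ⟨_, hN.isCalculus_hom hz hn, hN.injective_hom_of_subset hz hn subset_rfl⟩
  rw [stdCalculus, dif_pos h]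
  exact h.choose_spec

theorem extFun_eq_affiliatedImage_hom {G : Set ℂ} {N : Finset ℂ} (hN : IsCalculusSet z G N)
    {K : Finset ℂ} (hK : IsAdmissible A (ofZTransform z) G K) (f : C(G, ℂ)) :
    extFun A (ofZTransform z) f = affiliatedImage (hN.hom hz hn) f := by
  obtain ⟨M, hM⟩ := exists_isCalculusSet hz hn (isCompatibleSet_opSpectrum_sdiff hz hn hK.1)
  rw [extFun_eq hz hn f hK (hM.isCalculus_hom hz hn),
    hN.affiliatedImage_hom_restrict hM hz hn hK.2]

end Main

end HilbertModule

end

open HilbertModule in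
theorem mainTheorem2 {A E : Type*} [NonUnitalCStarAlgebra A] [PartialOrder A] [StarOrderedRing A]
    [NormedAddCommGroup E] [NormedSpace ℂ E] [SMul A E] [CStarModule A E] [CompleteSpace E]
    (T : E →ₗ.[ℂ] E) (hreg : IsRegular A T) (hnormal : IsNormal A T) :
    -- the usual functional calculus of `T` exists, is unique and is injective
    ((∃! ψ : C₀(opSpectrum A T, ℂ) →⋆ₙₐ[ℂ] Adjointable A E, IsCalculus T ψ) ∧
      IsCalculus T (stdCalculus A T) ∧ Function.Injective (stdCalculus A T)) ∧
    -- the functional calculus on `σ(T) \ K`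
    (∀ K : Finset ℂ, (∀ c ∈ K, IsInvertible A (subScalar T c)) →
      ∃ π : C₀((opSpectrum A T \ K : Set ℂ), ℂ) →⋆ₙₐ[ℂ] Adjointable A E,
        IsCalculus T π ∧
        (∀ π' : C₀((opSpectrum A T \ K : Set ℂ), ℂ) →⋆ₙₐ[ℂ] Adjointable A E,
          IsCalculus T π' → π' = π) ∧
        ∀ f : C(opSpectrum A T, ℂ),
          stdFun A T f = affiliatedImage π (restrictTo Set.sdiff_subset f)) ∧
    -- `f(T)` for compatible functions: a normal regular operator, independent of the choice of `K`
    (∀ (D : Set ℂ) (f : C(D, ℂ)), IsCompatibleDomain A T D →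
      IsRegular A (extFun A T f) ∧ IsNormal A (extFun A T f) ∧
      ∀ (K : Finset ℂ) (hK : IsAdmissible A T D K)
        (π : C₀((opSpectrum A T \ K : Set ℂ), ℂ) →⋆ₙₐ[ℂ] Adjointable A E),
        IsCalculus T π → extFun A T f = affiliatedImage π (restrictTo hK.2 f)) ∧
    -- the functional calculus on a compatible set
    (∀ G : Set ℂ, IsCompatibleSet A T G →
      ∃ π : C₀(G, ℂ) →⋆ₙₐ[ℂ] Adjointable A E,
        IsCalculus T π ∧
        (∀ π' : C₀(G, ℂ) →⋆ₙₐ[ℂ] Adjointable A E, IsCalculus T π' → π' = π) ∧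
        (∀ g : C₀(G, ℂ), extFun A T g.toContinuousMap =
          LinearMap.toPMap ((π g).1 : E →ₗ[ℂ] E) ⊤) ∧
        ∀ f : C(G, ℂ), extFun A T f = affiliatedImage π f) := by
  obtain ⟨z, hz, hn, rfl⟩ := exists_zTransform hreg hnormal
  obtain ⟨N₀, hN₀⟩ := exists_isCalculusSet hz hn (isCompatibleSet_opSpectrum hz hn)
  obtain ⟨hstd, hinj⟩ := isCalculus_stdCalculus hz hn
  refine ⟨⟨⟨_, hN₀.isCalculus_hom hz hn, fun ψ hψ => hN₀.eq_hom_of_isCalculus hz hn hψ⟩,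
    hstd, hinj⟩, ?_, ?_, ?_⟩
  · intro K hK
    obtain ⟨N, hN⟩ := exists_isCalculusSet hz hn (isCompatibleSet_opSpectrum_sdiff hz hn hK)
    refine ⟨_, hN.isCalculus_hom hz hn, fun π' hπ' => hN.eq_hom_of_isCalculus hz hn hπ',
      fun f => ?_⟩
    rw [stdFun, hN₀.eq_hom_of_isCalculus hz hn hstd]
    exact hN₀.affiliatedImage_hom_restrict hN hz hn Set.sdiff_subset f
  · rintro D f ⟨K, hK⟩
    obtain ⟨π, hπ⟩ := exists_isCalculus_sdiff hz hn hK.1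
    refine ⟨?_, ?_, fun K' hK' π' hπ' => extFun_eq hz hn f hK' hπ'⟩
    · rw [extFun_eq hz hn f hK hπ]
      exact isRegular_affiliatedImage hπ.1 _
    · rw [extFun_eq hz hn f hK hπ]
      exact isNormal_affiliatedImage hπ.1 _
  · intro G hG
    obtain ⟨N, hN⟩ := exists_isCalculusSet hz hn hG
    obtain ⟨-, K, hK⟩ := hG
    refine ⟨_, hN.isCalculus_hom hz hn, fun π' hπ' => hN.eq_hom_of_isCalculus hz hn hπ',
      fun g => ?_, extFun_eq_affiliatedImage_hom hz hn hN hK⟩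
    rw [extFun_eq_affiliatedImage_hom hz hn hN hK]
    exact affiliatedImage_toContinuousMap (hN.isNondegenerate_hom hz hn) g
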